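/- Let $\mathbb T^2=\mathbb R^2/(2\mathbb Z)^2$ be the flat torus, identified with $[-1,1]^2$ with opposite sides glued, with geodesic distance $\mathsf d$. Let $\omega:[0,\infty)\to[0,\infty)$ be a non-Lipschitz Osgood modulus of continuity, i.e. $\omega$ is continuous on $[0,\infty)$, $C^1$ on $(0,\infty)$, increasing, concave, positive on $(0,\infty)$, and $$\omega(0)=0,\qquad \int_0^1\frac{ds}{\omega(s)}=\infty,\qquad \lim_{s\to0^+}\frac{s}{\omega(s)}=0 .$$ For $f:\mathbb T^2\to\mathbb R^2$ put $\|f\|_\omega=\|f\|_{C^0}+\sup_{x\ne y}\frac{|f(x)-f(y)|}{\omega(\mathsf d(x,y))}$, and let $c_\omega=c_\omega(\mathbb T^2;\mathbb R^2)$ be the closure of $C^\infty(\mathbb T^2;\mathbb R^2)$ with respect to $\|\cdot\|_\omega$. Let $L^1_{\rm per}(\mathbb R_+;c_\omega(\mathbb T^2;\mathbb R^2))$ be the space of strongly measurable fields $b:\mathbb R_+\to c_\omega$ with $b(t+1,\cdot)=b(t,\cdot)$ for all $t\ge0$ and $\int_0^1\|b(t,\cdot)\|_\omega\,dt<\infty$.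 The flow map $X^b$ of a field $b$ is the unique solution of $\frac{d}{dt}X^b_t(x)=b(t,X^b_t(x))$, $X^b_0(x)=x$, understood in integrated form. Fields on $[0,1]$ are identified with 1-periodic fields on $\mathbb R_+$ by repeating their values on $[0,1)$. Let $h_{\rm top}$ denote topological entropy, $h_{\rm top}(T)=\sup_\alpha\lim_{n\to\infty}\frac1n\log N\big(\bigvee_{i=0}^{n-1}T^{-i}\alpha\big)$, where $\alpha$ ranges over the finite open covers and $N(\cdot)$ is the cardinality of a smallest subcover. For every integer $N\ge1$ put $x_N=(-\tfrac12,-1+2^{-N+1})\in\mathbb T^2$ and $r_N=2^{-N-2}$. Then there are velocity fields $b_N:[0,1]\times\mathbb T^2\to\mathbb R^2$, $N\ge1$, and $b:\mathbb R_+\times\mathbb T^2\to\mathbb R^2$ such that: 1. For every $N\ge 1$, $b_N$ is smooth and divergence-free, $b_N\in C^0([0,1];c_\omega)$ with $\|b_N\|_{C^0([0,1];c_\omega)}\le N^{-2}$, $\operatorname{supp}(b_N)\subseteq[0,1]\times B_{r_N}(0)$, the flow map $X^{b_N}$ exists and is unique, $X^{b_N}_1$ is continuous, and $h_{\rm top}(X_1^{b_N})\ge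 N$. 2. The balls $\overline{B_{r_N}(x_N)}$, $N\ge1$, are pairwise disjoint, and $b(t,x)=\sum_{N\ge1}b_N(t,x-x_N)$ for all $t\ge0$ and $x\in\mathbb T^2$. 3. $b\in L^1_{\rm per}(\mathbb R_+;c_\omega(\mathbb T^2;\mathbb R^2))$, and $\|b(t,\cdot)\|_\omega\le\sum_{N\ge1}N^{-2}$ for all $t\ge0$. 4. The flow map $X^b$ exists and is unique, and $X_1^b$ is continuous. For every $N\ge 1$ one has $X_1^b(x)=x_N+X_1^{b_N}(x-x_N)$ for $x\in B_{r_N}(x_N)$, and $X_1^b\big(\overline{B_{r_N}(x_N)}\big)=\overline{B_{r_N}(x_N)}$. 5. $h_{\rm top}(X_1^b)=+\infty$. -/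

import Mathlib

open Set Filter Topology MeasureTheory
open scoped ENNReal

noncomputable section

namespace OsgoodEntropy

/-! ### The flat torus -/

/-- The Euclidean plane. -/
abbrev Plane : Type := EuclideanSpace ℝ (Fin 2)

/-- The flat torus `ℝ² / (2ℤ)²`, that is `[-1,1]²` with opposite sides identified. The `ℓ²` product
distance of the two circles of length `2` is the geodesic distance. -/
abbrev Torus : Type := PiLp 2 (fun _ : Fin 2 => AddCircle (2 : ℝ))

/-- The covering projection `ℝ² → 𝕋²`. -/
def proj (v : Plane) : Torus := WithLp.toLp 2 (fun i => ((v i : ℝ) : AddCircle (2 : ℝ)))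

/-! ### Moduli of continuity and the space `c_ω` -/

/-- Non-Lipschitz Osgood moduli of continuity on `[0, ∞)`. Differentiability is asked on `(0, ∞)`:
the last condition forces an infinite slope at `0`. -/
structure IsOsgoodModulus (ω : ℝ → ℝ) : Prop where
  continuousOn : ContinuousOn ω (Ici 0)
  contDiffOn : ContDiffOn ℝ 1 ω (Ioi 0)
  map_zero : ω 0 = 0
  pos : ∀ s, 0 < s → 0 < ω s
  monotoneOn : MonotoneOn ω (Ici 0)
  concaveOn : ConcaveOn ℝ (Ici 0) ω
  osgood : ∫⁻ s in Ioc (0 : ℝ) 1, ENNReal.ofReal (1 / ω s) = ∞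
  nonLipschitz : Tendsto (fun s => s / ω s) (𝓝[>] 0) (𝓝 0)

/-- `[f]_ω`, with value `∞` if the quotients are unbounded. -/
def omegaSeminorm (ω : ℝ → ℝ) (f : Torus → Plane) : ℝ≥0∞ :=
  ⨆ (x : Torus) (y : Torus) (_ : x ≠ y), ENNReal.ofReal (‖f x - f y‖ / ω (dist x y))

/-- `‖f‖_ω = ‖f‖_{C⁰} + [f]_ω`. -/
def omegaNorm (ω : ℝ → ℝ) (f : Torus → Plane) : ℝ≥0∞ :=
  (⨆ x : Torus, ENNReal.ofReal ‖f x‖) + omegaSeminorm ω f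

/-- Smooth maps on the torus: their periodic lifts to the plane are smooth. -/
def IsSmooth (f : Torus → Plane) : Prop :=
  ContDiff ℝ ((⊤ : ℕ∞) : WithTop ℕ∞) (fun v : Plane => f (proj v))

/-- `c_ω`: the closure of the smooth maps in `C_ω` for `‖·‖_ω`. -/
def cOmega (ω : ℝ → ℝ) : Set (Torus → Plane) :=
  {f | omegaNorm ω f < ∞ ∧
    ∀ ε : ℝ≥0∞, 0 < ε → ∃ g : Torus → Plane, IsSmooth g ∧ omegaNorm ω (f - g) < ε}

/-! ### Time-dependent velocity fields, `u t x` being the velocity at time `t` and position `x` -/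

/-- `u` is strongly (Bochner) measurable on `[0, ∞)` with values in `c_ω`: almost everywhere it is
the limit, in the `ω`-norm, of simple functions with values in `c_ω`. -/
def IsStronglyMeasurable (ω : ℝ → ℝ) (u : ℝ → Torus → Plane) : Prop :=
  ∃ s : ℕ → SimpleFunc ℝ (Torus → Plane), (∀ n t, s n t ∈ cOmega ω) ∧
    ∀ᵐ t ∂(volume.restrict (Ici (0 : ℝ))),
      Tendsto (fun n => omegaNorm ω (u t - s n t)) atTop (𝓝 0)

/-- `u ∈ L¹_per(ℝ₊; c_ω(𝕋²; ℝ²))`. Values at negative times are irrelevant. -/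
structure MemLOnePer (ω : ℝ → ℝ) (u : ℝ → Torus → Plane) : Prop where
  mem : ∀ t, 0 ≤ t → u t ∈ cOmega ω
  periodic : ∀ t, 0 ≤ t → u (t + 1) = u t
  measurable : IsStronglyMeasurable ω u
  integrable : ∫⁻ t in Icc (0 : ℝ) 1, omegaNorm ω (u t) < ∞

/-- `u ∈ C⁰([0,1]; c_ω(𝕋²; ℝ²))`. -/
structure MemCZero (ω : ℝ → ℝ) (u : ℝ → Torus → Plane) : Prop where
  mem : ∀ t ∈ Icc (0 : ℝ) 1, u t ∈ cOmega ω
  continuous : ∀ t ∈ Icc (0 : ℝ) 1,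
    Tendsto (fun s => omegaNorm ω (u s - u t)) (𝓝[Icc 0 1] t) (𝓝 0)

/-- `‖u‖_{C⁰([0,1]; c_ω)}`. -/
def cZeroNorm (ω : ℝ → ℝ) (u : ℝ → Torus → Plane) : ℝ≥0∞ :=
  ⨆ t ∈ Icc (0 : ℝ) 1, omegaNorm ω (u t)

/-- `u` is smooth on `[0,1] × 𝕋²`. -/
def IsSmoothField (u : ℝ → Torus → Plane) : Prop :=
  ContDiffOn ℝ ((⊤ : ℕ∞) : WithTop ℕ∞) (fun p : ℝ × Plane => u p.1 (proj p.2))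
    (Icc 0 1 ×ˢ univ)

/-- `div u(t, ·) = 0` for all `t ∈ [0,1]`. -/
def IsIncompressible (u : ℝ → Torus → Plane) : Prop :=
  ∀ t ∈ Icc (0 : ℝ) 1, ∀ v : Plane,
    ∑ i : Fin 2, (fderiv ℝ (fun w : Plane => u t (proj w)) v (EuclideanSpace.single i 1)) i = 0

/-- The support of `u` on `[0,1] × 𝕋²`. -/
def spaceTimeSupport (u : ℝ → Torus → Plane) : Set (ℝ × Torus) :=
  closure {p | p.1 ∈ Icc (0 : ℝ) 1 ∧ u p.1 p.2 ≠ 0}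

/-- The 1-periodic field on `ℝ₊` that agrees with `u` on `[0, 1)`. -/
def periodize (u : ℝ → Torus → Plane) : ℝ → Torus → Plane :=
  fun t => u (Int.fract t)

/-! ### Flow maps -/

/-- `γ` solves `γ' = u(t, γ)` on `[0, ∞)`, in the integrated (Carathéodory) sense, written for a
lift of `γ` to the plane. -/
def IsTrajectory (u : ℝ → Torus → Plane) (γ : ℝ → Torus) : Prop :=
  ∃ g : ℝ → Plane, ∀ t, 0 ≤ t →
    γ t = proj (g t) ∧
    IntervalIntegrable (fun s => u s (proj (g s))) volume 0 t ∧
    g t = g 0 + ∫ s in (0 : ℝ)..t, u s (proj (g s))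

/-- `X` solves the flow equation of `u`. -/
def SolvesFlow (u : ℝ → Torus → Plane) (X : ℝ → Torus → Torus) : Prop :=
  ∀ x, X 0 x = x ∧ IsTrajectory u (fun t => X t x)

/-- `X` is the flow map of `u`: it solves the flow equation, and no other map does. -/
def IsFlowMap (u : ℝ → Torus → Plane) (X : ℝ → Torus → Torus) : Prop :=
  SolvesFlow u X ∧ ∀ Y, SolvesFlow u Y → ∀ t, 0 ≤ t → Y t = X t

/-! ### Topological entropy through open covers -/

section Entropy

variable {α : Type*}

/-- The cardinality of the smallest subcover of `C`. -/
def minSubcover (C : Set (Set α)) : ℕ∞ :=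
  ⨅ (D : Set (Set α)) (_ : D ⊆ C) (_ : ⋃₀ D = univ), D.encard

/-- The join of `C, T⁻¹ C, …, T^{-(n-1)} C`. -/
def iterJoin (T : α → α) (C : Set (Set α)) (n : ℕ) : Set (Set α) :=
  {S | ∃ A : Fin n → Set α, (∀ i, A i ∈ C) ∧ S = ⋂ i : Fin n, T^[(i : ℕ)] ⁻¹' (A i)}

/-- The entropy of `T` with respect to the cover `C`. The limit exists by subadditivity, so it is
the upper limit. -/
def coverEntropy (T : α → α) (C : Set (Set α)) : EReal :=
  limsup (fun n : ℕ => ENNReal.log ((minSubcover (iterJoin T C n) : ℕ∞) : ℝ≥0∞) / (n : EReal)) atTop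

/-- The topological entropy: the supremum over all finite open covers. -/
def topEntropy [TopologicalSpace α] (T : α → α) : EReal :=
  ⨆ (C : Set (Set α)) (_ : C.Finite) (_ : ∀ U ∈ C, IsOpen U) (_ : ⋃₀ C = univ), coverEntropy T C

end Entropy

/-! ### Position and size of the blocks -/

/-- `x_N = (-1/2, -1 + 2^{-N+1})`. -/
def blockCenter (N : ℕ+) : Torus := proj !₂[-1 / 2, -1 + (2 : ℝ) ^ (-((N : ℕ) : ℤ) + 1)]

/-- `2^{-N-2}`. -/
def blockRadius (N : ℕ+) : ℝ := (2 : ℝ) ^ (-((N : ℕ) : ℤ) - 2)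

end OsgoodEntropy

end

open OsgoodEntropy

namespace OsgoodEntropy

/-! ### Horseshoes and lower bounds for entropy defined by open covers. -/

section Entropy

variable {α : Type*}

/-! Under a dilation of the plane by a factor `ρ`, a compactly supported velocity field `W` becomes
`ρ W(·/ρ)`. Its flow is merely conjugated, so it keeps its entropy, and its Lipschitz constant does
not change, while its amplitude and support shrink by `ρ`. Since `s / ω s → 0`, fields with a fixed
Lipschitz constant and vanishing amplitude have vanishing `ω`-norm (`exists_forall_omegaNorm_le`).
Hence any amount of entropy fits in an arbitrarily small ball at an arbitrarily small cost in
`ω`-norm, and blocks of entropy at least `N` and norm at most `N⁻²` can be summed over disjoint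
balls.

A block runs two truncated Hamiltonian fields in turn: the horizontal shear `(y, 0)`, then a field
equal to `(0, 64 m (x - j))` near each line `x = j`, `j < m`. On the relevant region the time-one
map is `(x, y) ↦ (x + y, y + 64 m (x + y - j))`. With `y_k = x_{k+1} - x_k`, an orbit with itinerary
`w` is a solution of `x_{k+1} - 2 x_k + x_{k-1} = 64 m (x_k - w_k)`. The large factor makes this a
contracting fixed point problem (`exists_periodic_solution`), so every periodic word is realised
near the lines it names. This gives a horseshoe with `m` symbols (`IsShearPair.exists_horseshoe`)
and entropy at least `log m` (`log_le_topEntropy`); `m = 3 ^ N` is enough since `log 3 ≥ 1`.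

For the sum, the `ω`-norms add up, which yields membership in `c_ω` and a uniform modulus of
continuity. Uniqueness of trajectories then follows from Osgood's lemma
(`IsOsgoodModulus.eq_zero_of_le_integral`, `IsTrajectory.eq_of_eq_zero`), which needs no common
Lipschitz constant for the blocks. The flow of the sum is the gluing of the block flows, so it
contains a translate of each horseshoe, and its entropy exceeds every `N`. -/

/-- If every word of length `n` in `m` letters is the itinerary of a point through disjoint sets
`H j`, then any cover whose members each meet only one `H j` has large joins. -/
theorem pow_le_minSubcover_iterJoin {T : α → α} {m : ℕ} {H : Fin m → Set α}
    {n : ℕ}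
    (horb : ∀ w : Fin n → Fin m, ∃ x, ∀ i : Fin n, T^[(i : ℕ)] x ∈ H (w i)) :
    ((m ^ n : ℕ) : ℕ∞) ≤
      minSubcover (iterJoin T (range fun j => (⋃ k ∈ ({j}ᶜ : Set (Fin m)), H k)ᶜ) n) := by
  refine le_iInf fun D => le_iInf fun hD => le_iInf fun hcov => ?_
  choose x hx using horb
  have hmem : ∀ w, ∃ S ∈ D, x w ∈ S := fun w => by
    have : x w ∈ ⋃₀ D := hcov ▸ mem_univ _
    exact this
  choose S hSD hxS using hmem
  have hinj : Function.Injective S := by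
    -- A member of the join that contains `x w` must be built from the cover elements labelled by
    -- `w`, however it is written. Applied to one set and two words, this recovers the word from the
    -- set.
    have key : ∀ w (A : Fin n → Set α),
        (∀ i, A i ∈ range fun j => (⋃ k ∈ ({j}ᶜ : Set (Fin m)), H k)ᶜ) →
        x w ∈ ⋂ i : Fin n, T^[(i : ℕ)] ⁻¹' (A i) →
        ∀ i, A i = (⋃ k ∈ ({w i}ᶜ : Set (Fin m)), H k)ᶜ := by
      intro w A hA hxA i
      obtain ⟨j, hj⟩ := hA i
      have h1 := mem_iInter.1 hxA i
      rw [mem_preimage, ← hj] at h1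
      have h2 := hx w i
      by_cases hwj : w i = j
      · rw [← hj, hwj]
      · exact absurd (mem_biUnion (show w i ∈ ({j}ᶜ : Set (Fin m)) from hwj) h2) h1
    intro w w' hww
    obtain ⟨A, hA, hSA⟩ := hD (hSD w)
    have h1 := key w A hA (hSA ▸ hxS w)
    have h2 := hxS w'
    rw [← hww, hSA] at h2
    have h3 := key w' A hA h2
    funext i
    by_contra hne
    have h4 : T^[(i : ℕ)] (x w) ∈ (⋃ k ∈ ({w' i}ᶜ : Set (Fin m)), H k)ᶜ := by
      rw [← h3 i]
      exact mem_iInter.1 (hSA ▸ hxS w : x w ∈ ⋂ i : Fin n, T^[(i : ℕ)] ⁻¹' (A i)) i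
    exact h4 (mem_biUnion (show w i ∈ ({w' i}ᶜ : Set (Fin m)) from hne) (hx w i))
  calc ((m ^ n : ℕ) : ℕ∞) = (univ : Set (Fin n → Fin m)).encard := by
        rw [encard_univ, ENat.card_eq_coe_fintype_card]; simp
    _ = (range S).encard := by rw [← image_univ, hinj.encard_image]
    _ ≤ D.encard := encard_le_encard (range_subset_iff.2 hSD)

/-- A topological horseshoe with `m` symbols forces entropy at least `log m`. -/
theorem log_le_topEntropy [TopologicalSpace α] {T : α → α} {m : ℕ} {H : Fin m → Set α}
    (hclosed : ∀ j, IsClosed (H j)) (hdisj : Pairwise fun i j => Disjoint (H i) (H j))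
    (hm : 0 < m)
    (horb : ∀ n : ℕ, 0 < n → ∀ w : Fin n → Fin m, ∃ x, ∀ i : Fin n, T^[(i : ℕ)] x ∈ H (w i)) :
    ENNReal.log (m : ℝ≥0∞) ≤ topEntropy T := by
  set C : Set (Set α) := range fun j => (⋃ k ∈ ({j}ᶜ : Set (Fin m)), H k)ᶜ with hC
  have hopen : ∀ U ∈ C, IsOpen U := by
    rintro _ ⟨j, rfl⟩
    exact ((toFinite _).isClosed_biUnion fun k _ => hclosed k).isOpen_compl
  have hcov : ⋃₀ C = univ := by
    refine eq_univ_of_forall fun x => ?_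
    obtain ⟨j, hj⟩ : ∃ j : Fin m, ∀ k, x ∈ H k → k = j := by
      by_cases h : ∃ j, x ∈ H j
      · obtain ⟨j, hj⟩ := h
        exact ⟨j, fun k hk => by_contra fun hne => disjoint_left.1 (hdisj hne) hk hj⟩
      · push Not at h
        -- A point outside every `H k` lies in all members of the cover, so any symbol will do.
        exact ⟨⟨0, hm⟩, fun k hk => absurd hk (h k)⟩
    refine ⟨_, ⟨j, rfl⟩, ?_⟩
    simp only [mem_compl_iff, mem_iUnion, mem_singleton_iff, not_exists]
    exact fun k hkj hk => hkj (hj k hk)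
  refine le_trans ?_ (le_iSup₂_of_le C (finite_range _)
    (le_iSup₂_of_le hopen hcov le_rfl : coverEntropy T C ≤ _))
  refine le_limsup_of_frequently_le (Eventually.frequently ?_)
  filter_upwards [eventually_gt_atTop 0] with n hn
  have h1 := ENat.toENNReal_le.2 (pow_le_minSubcover_iterJoin (horb n hn))
  have hn0 : (0 : EReal) < n := by exact_mod_cast hn
  rw [EReal.le_div_iff_mul_le hn0 (EReal.natCast_ne_top n), mul_comm, ← ENNReal.log_pow]
  refine ENNReal.log_monotone (le_trans (le_of_eq ?_) h1)
  simp

/-- `3 ^ N` symbols give entropy at least `N`. -/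
theorem natCast_le_log_three_pow (N : ℕ) : (N : EReal) ≤ ENNReal.log ((3 ^ N : ℕ) : ℝ≥0∞) := by
  have h3 : (1 : EReal) ≤ ENNReal.log 3 := by
    have h : ENNReal.log 3 = ((Real.log 3 : ℝ) : EReal) := by
      have := ENNReal.log_ofReal_of_pos (show (0 : ℝ) < 3 by norm_num)
      simpa using this
    rw [h]
    have : (1 : ℝ) ≤ Real.log 3 := by
      rw [Real.le_log_iff_exp_le (by norm_num)]
      exact Real.exp_one_lt_three.le
    exact_mod_cast this
  push_cast
  rw [ENNReal.log_pow]
  calc (N : EReal) = N * 1 := (mul_one _).symm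
    _ ≤ N * ENNReal.log 3 := mul_le_mul_of_nonneg_left h3 (by exact_mod_cast Nat.zero_le N)

end Entropy

/-! ### Lifts to the plane -/

theorem proj_apply (v : Plane) (i : Fin 2) : proj v i = ((v i : ℝ) : AddCircle (2 : ℝ)) := rfl

theorem proj_add (v w : Plane) : proj (v + w) = proj v + proj w := by
  ext i; simp [proj_apply]

theorem proj_sub (v w : Plane) : proj (v - w) = proj v - proj w := by
  ext i; simp [proj_apply]

/-- The representative of a point of the torus in `[-1, 1)²`. -/
noncomputable def rep (x : Torus) : Plane :=
  haveI : Fact ((0 : ℝ) < 2) := ⟨two_pos⟩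
  WithLp.toLp 2 (fun i => (AddCircle.equivIco (2 : ℝ) (-1) (x i) : ℝ))

theorem rep_mem (x : Torus) (i : Fin 2) : rep x i ∈ Ico (-1 : ℝ) 1 := by
  have : Fact ((0 : ℝ) < 2) := ⟨two_pos⟩
  have h := (AddCircle.equivIco (2 : ℝ) (-1) (x i)).2
  have e : (-1 : ℝ) + 2 = 1 := by norm_num
  exact ⟨h.1, h.2.trans_eq e⟩

theorem proj_rep (x : Torus) : proj (rep x) = x := by
  have : Fact ((0 : ℝ) < 2) := ⟨two_pos⟩
  ext i
  exact AddCircle.coe_equivIco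

theorem rep_proj {v : Plane} (hv : ∀ i, v i ∈ Ico (-1 : ℝ) 1) : rep (proj v) = v := by
  have : Fact ((0 : ℝ) < 2) := ⟨two_pos⟩
  ext i
  have e : (-1 : ℝ) + 2 = 1 := by norm_num
  exact AddCircle.equivIco_coe_of_mem (p := (2 : ℝ)) (a := -1) (by rw [e]; exact hv i)

theorem norm_coe_le_abs (x : ℝ) : ‖(x : AddCircle (2 : ℝ))‖ ≤ |x| := by
  rcases le_or_gt |x| 1 with h | h
  · exact ((AddCircle.norm_coe_eq_abs_iff (p := (2 : ℝ)) two_ne_zero).2 (by simpa using h)).le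
  · refine (AddCircle.norm_le_half_period (p := (2 : ℝ)) two_ne_zero).trans ?_
    simpa using h.le

theorem norm_proj_le (v : Plane) : ‖proj v‖ ≤ ‖v‖ := by
  rw [PiLp.norm_eq_of_L2, EuclideanSpace.norm_eq]
  refine Real.sqrt_le_sqrt (Finset.sum_le_sum fun i _ => ?_)
  gcongr
  exact norm_coe_le_abs _

theorem norm_proj_eq {v : Plane} (hv : ∀ i, |v i| ≤ 1) : ‖proj v‖ = ‖v‖ := by
  rw [PiLp.norm_eq_of_L2, EuclideanSpace.norm_eq]
  congr 1
  refine Finset.sum_congr rfl fun i _ => ?_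
  rw [proj_apply, (AddCircle.norm_coe_eq_abs_iff (p := (2 : ℝ)) two_ne_zero).2
    (by simpa using hv i), Real.norm_eq_abs]

theorem norm_rep (x : Torus) : ‖rep x‖ = ‖x‖ := by
  conv_rhs => rw [← proj_rep x]
  exact (norm_proj_eq fun i => abs_le.2 ⟨(rep_mem x i).1, (rep_mem x i).2.le⟩).symm

theorem abs_apply_le_norm (v : Plane) (i : Fin 2) : |v i| ≤ ‖v‖ := by
  simpa using PiLp.norm_apply_le v i

theorem rep_proj_of_norm_lt {v : Plane} (hv : ‖v‖ < 1) : rep (proj v) = v :=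
  rep_proj fun i => ⟨(abs_lt.1 ((abs_apply_le_norm v i).trans_lt hv)).1.le,
    (abs_lt.1 ((abs_apply_le_norm v i).trans_lt hv)).2⟩

theorem dist_proj_le (v w : Plane) : dist (proj v) (proj w) ≤ ‖v - w‖ := by
  rw [dist_eq_norm, ← proj_sub]
  exact norm_proj_le _

theorem continuous_proj : Continuous proj :=
  (LipschitzWith.of_dist_le_mul (K := 1) fun v w => by
    simpa [dist_eq_norm] using dist_proj_le v w).continuous

/-- The representative in `[-1, 1)²` of `x - y` is as short as possible; adding it to a lift of `y`
gives a lift of `x` that realises the geodesic distance. -/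
theorem exists_lifts (x y : Torus) :
    ∃ v w : Plane, proj v = x ∧ proj w = y ∧ ‖v - w‖ = dist x y := by
  refine ⟨rep y + rep (x - y), rep y, ?_, proj_rep y, ?_⟩
  · rw [proj_add, proj_rep, proj_rep, add_sub_cancel]
  · rw [add_sub_cancel_left, norm_rep, dist_eq_norm]

theorem proj_add_sub_of_eq {p q : Plane} (h : proj p = proj q) (v : Plane) :
    proj (v + (p - q)) = proj v := by
  rw [proj_add, proj_sub, h, sub_self, add_zero]

/-! ### The `ω`-norm -/

theorem ofReal_norm_le_tsum {ι : Type*} {a : ι → Plane} {s : Plane} (h : HasSum a s) :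
    ENNReal.ofReal ‖s‖ ≤ ∑' i, ENNReal.ofReal ‖a i‖ := by
  refine le_of_tendsto ((ENNReal.continuous_ofReal.comp continuous_norm).continuousAt.tendsto.comp h)
    (Eventually.of_forall fun t => ?_)
  calc ENNReal.ofReal ‖∑ i ∈ t, a i‖ ≤ ENNReal.ofReal (∑ i ∈ t, ‖a i‖) :=
        ENNReal.ofReal_le_ofReal (norm_sum_le _ _)
    _ = ∑ i ∈ t, ENNReal.ofReal ‖a i‖ := ENNReal.ofReal_sum_of_nonneg fun _ _ => norm_nonneg _
    _ ≤ _ := ENNReal.sum_le_tsum _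

variable {ω : ℝ → ℝ}

theorem omegaNorm_zero : omegaNorm ω (0 : Torus → Plane) = 0 := by
  simp [omegaNorm, omegaSeminorm]

/-- Both suprema are bounded termwise, so pointwise convergence alone gives countable subadditivity.
The same estimate controls the full sum of blocks, its tails and its increments in time. -/
theorem omegaNorm_le_tsum (hω : ∀ s, 0 < s → 0 < ω s) {ι : Type*} {f : ι → Torus → Plane}
    {g : Torus → Plane} (h : ∀ x, HasSum (fun i => f i x) (g x)) :
    omegaNorm ω g ≤ ∑' i, omegaNorm ω (f i) := by
  unfold omegaNorm
  rw [ENNReal.tsum_add]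
  refine add_le_add (iSup_le fun x => ?_) (iSup_le fun x => iSup_le fun y => iSup_le fun hxy => ?_)
  · exact (ofReal_norm_le_tsum (h x)).trans
      (ENNReal.tsum_le_tsum fun i => le_iSup (fun x => ENNReal.ofReal ‖f i x‖) x)
  · have hpos := hω _ (dist_pos.2 hxy)
    rw [ENNReal.ofReal_div_of_pos hpos, div_eq_mul_inv]
    refine (mul_le_mul_left (ofReal_norm_le_tsum ((h x).sub (h y))) _).trans ?_
    rw [← ENNReal.tsum_mul_right]
    refine ENNReal.tsum_le_tsum fun i => ?_
    rw [← div_eq_mul_inv, ← ENNReal.ofReal_div_of_pos hpos]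
    exact le_iSup_of_le x (le_iSup_of_le y (le_iSup_of_le hxy le_rfl))

theorem omegaNorm_smul_le (c : ℝ) (f : Torus → Plane) :
    omegaNorm ω (c • f) ≤ ENNReal.ofReal |c| * omegaNorm ω f := by
  unfold omegaNorm
  rw [mul_add]
  refine add_le_add (iSup_le fun x => ?_) (iSup_le fun x => iSup_le fun y => iSup_le fun hxy => ?_)
  · rw [Pi.smul_apply, norm_smul, Real.norm_eq_abs, ENNReal.ofReal_mul (abs_nonneg _)]
    gcongr
    exact le_iSup (fun x => ENNReal.ofReal ‖f x‖) x
  · rw [Pi.smul_apply, Pi.smul_apply, ← smul_sub, norm_smul, Real.norm_eq_abs, mul_div_assoc,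
      ENNReal.ofReal_mul (abs_nonneg _)]
    gcongr
    exact le_iSup_of_le x (le_iSup_of_le y (le_iSup_of_le hxy le_rfl))

theorem omegaNorm_add_le (hω : ∀ s, 0 < s → 0 < ω s) (f g : Torus → Plane) :
    omegaNorm ω (f + g) ≤ omegaNorm ω f + omegaNorm ω g := by
  have := omegaNorm_le_tsum hω (f := ![f, g]) (g := f + g) fun x => by
    convert hasSum_fintype (fun i => (![f, g] : Fin 2 → Torus → Plane) i x) using 1
    simp [Fin.sum_univ_two]
  simpa [tsum_fintype, Fin.sum_univ_two] using this

theorem omegaNorm_comp_sub_le (f : Torus → Plane) (a : Torus) :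
    omegaNorm ω (fun x => f (x - a)) ≤ omegaNorm ω f := by
  refine add_le_add (iSup_le fun x => le_iSup (fun x => ENNReal.ofReal ‖f x‖) _)
    (iSup_le fun x => iSup_le fun y => iSup_le fun hxy => ?_)
  refine le_iSup_of_le (x - a) (le_iSup_of_le (y - a) (le_iSup_of_le ?_ ?_))
  · simpa [sub_left_inj] using hxy
  · rw [dist_sub_right]

theorem norm_sub_le_of_omegaNorm_le (hω : IsOsgoodModulus ω) {f : Torus → Plane} {C : ℝ}
    (hC : 0 ≤ C) (h : omegaNorm ω f ≤ ENNReal.ofReal C) (x y : Torus) :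
    ‖f x - f y‖ ≤ C * ω (dist x y) := by
  rcases eq_or_ne x y with rfl | hxy
  · simp [hω.map_zero]
  have hpos := hω.pos _ (dist_pos.2 hxy)
  have h1 : ENNReal.ofReal (‖f x - f y‖ / ω (dist x y)) ≤ omegaSeminorm ω f :=
    le_iSup_of_le x (le_iSup_of_le y (le_iSup_of_le hxy le_rfl))
  exact (div_le_iff₀ hpos).1 ((ENNReal.ofReal_le_ofReal_iff hC).1
    (h1.trans (le_add_self.trans h)))

/-- Lipschitz fields of small amplitude have small `ω`-norm, for a fixed Lipschitz constant. -/
theorem exists_forall_omegaNorm_le (hω : IsOsgoodModulus ω) {L ε : ℝ} (hL : 0 ≤ L) (hε : 0 < ε) :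
    ∃ η > 0, ∀ f : Torus → Plane, (∀ x y, ‖f x - f y‖ ≤ L * dist x y) → (∀ x, ‖f x‖ ≤ η) →
      omegaNorm ω f ≤ ENNReal.ofReal ε := by
  have hL1 : 0 < L + 1 := by linarith
  have h1 := hω.nonLipschitz.eventually (gt_mem_nhds (show 0 < ε / 2 / (L + 1) by positivity))
  obtain ⟨δ, hδ, hδs⟩ := mem_nhdsGT_iff_exists_Ioo_subset.1 h1
  have hδ : 0 < δ := hδ
  have hωδ : 0 < ω (δ / 2) := hω.pos _ (by positivity)
  -- At distances below `δ` the Lipschitz bound wins, because `s / ω s` is small there. At larger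
  -- distances `ω` is at least `ω (δ / 2)`, and the amplitude bound suffices.
  refine ⟨min (ε / 2) (ε / 4 * ω (δ / 2)), by positivity, fun f hf hη => ?_⟩
  have e : ENNReal.ofReal ε = ENNReal.ofReal (ε / 2) + ENNReal.ofReal (ε / 2) := by
    rw [← ENNReal.ofReal_add (by positivity) (by positivity), add_halves]
  rw [e]
  refine add_le_add (iSup_le fun x => ?_) (iSup_le fun x => iSup_le fun y => iSup_le fun hxy => ?_)
  · exact ENNReal.ofReal_le_ofReal ((hη x).trans (min_le_left _ _))
  refine ENNReal.ofReal_le_ofReal ?_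
  have hd := dist_pos.2 hxy
  have hpos := hω.pos _ hd
  rcases lt_or_ge (dist x y) δ with hlt | hge
  · have h2 : dist x y / ω (dist x y) < ε / 2 / (L + 1) := hδs ⟨hd, hlt⟩
    calc ‖f x - f y‖ / ω (dist x y) ≤ L * dist x y / ω (dist x y) := by gcongr; exact hf x y
      _ = L * (dist x y / ω (dist x y)) := mul_div_assoc _ _ _
      _ ≤ (L + 1) * (ε / 2 / (L + 1)) := by gcongr; linarith
      _ = ε / 2 := by field_simp
  · rw [div_le_iff₀ hpos]
    have h3 : ω (δ / 2) ≤ ω (dist x y) :=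
      hω.monotoneOn (by simp; positivity) hd.le (by linarith)
    calc ‖f x - f y‖ ≤ ‖f x‖ + ‖f y‖ := norm_sub_le _ _
      _ ≤ ε / 4 * ω (δ / 2) + ε / 4 * ω (δ / 2) :=
        add_le_add ((hη x).trans (min_le_right _ _)) ((hη y).trans (min_le_right _ _))
      _ = ε / 2 * ω (δ / 2) := by ring
      _ ≤ ε / 2 * ω (dist x y) := by gcongr

/-! ### The space `c_ω` -/

theorem IsSmooth.mem_cOmega {f : Torus → Plane} (hf : IsSmooth f) (h : omegaNorm ω f < ∞) :
    f ∈ cOmega ω :=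
  ⟨h, fun ε hε => ⟨f, hf, by rw [sub_self, omegaNorm_zero]; exact hε⟩⟩

theorem IsSmooth.comp_sub {f : Torus → Plane} (hf : IsSmooth f) (a : Torus) :
    IsSmooth (fun x => f (x - a)) := by
  have h : (fun v : Plane => f (proj v - a)) = fun v => f (proj (v - rep a)) := by
    funext v; rw [proj_sub, proj_rep]
  unfold IsSmooth
  rw [h]
  exact ContDiff.comp (g := fun v : Plane => f (proj v)) hf (contDiff_id.sub contDiff_const)

/-- A sum of smooth maps that converges in the `ω`-norm lies in `c_ω`. -/
theorem mem_cOmega_of_hasSum (hω : ∀ s, 0 < s → 0 < ω s) {ι : Type*} {f : ι → Torus → Plane}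
    {g : Torus → Plane} (hf : ∀ i, IsSmooth (f i)) (h : ∀ x, HasSum (fun i => f i x) (g x))
    (hsum : ∑' i, omegaNorm ω (f i) ≠ ∞) : g ∈ cOmega ω := by
  refine ⟨(omegaNorm_le_tsum hω h).trans_lt hsum.lt_top, fun ε hε => ?_⟩
  obtain ⟨s, hs⟩ := ((ENNReal.tendsto_tsum_compl_atTop_zero hsum).eventually
    (gt_mem_nhds hε)).exists
  refine ⟨fun x => ∑ i ∈ s, f i x, ?_, lt_of_le_of_lt ?_ hs⟩
  · exact ContDiff.sum fun i _ => hf i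
  · refine omegaNorm_le_tsum hω (f := fun i : {i // i ∉ s} => f i) fun x => ?_
    have := (s.hasSum_compl_iff (f := fun i => f i x) (a := g x - ∑ i ∈ s, f i x)).2
      (by simpa using h x)
    exact this

/-! ### Osgood's uniqueness theorem -/

theorem IsOsgoodModulus.continuousOn_inv {ω : ℝ → ℝ} (hω : IsOsgoodModulus ω) :
    ContinuousOn (fun s => 1 / ω s) (Ioi 0) :=
  continuousOn_const.div (hω.contDiffOn.continuousOn) fun s hs => (hω.pos s hs).ne'

/-- Osgood's lemma: a modulus of continuity with divergent integral of `1 / ω` forces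
solutions of the integral inequality to vanish. -/
theorem IsOsgoodModulus.eq_zero_of_le_integral {ω : ℝ → ℝ} (hω : IsOsgoodModulus ω) {C T : ℝ}
    (hC : 0 ≤ C) (hT : 0 ≤ T) {φ : ℝ → ℝ} (hφ : ContinuousOn φ (Icc 0 T))
    (h0 : ∀ t ∈ Icc 0 T, 0 ≤ φ t) (h : ∀ t ∈ Icc 0 T, φ t ≤ C * ∫ s in (0 : ℝ)..t, ω (φ s)) :
    φ T = 0 := by
  by_contra hne
  have ha : 0 < φ T := lt_of_le_of_ne (h0 T (right_mem_Icc.2 hT)) (Ne.symm hne)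
  set a := φ T with ha_def
  have hωφ : ContinuousOn (fun s => ω (φ s)) (Icc 0 T) := hω.continuousOn.comp hφ h0
  -- The extension is continuous on the whole line, so its primitive has two-sided derivatives also
  -- at `0` and `T`.
  set f : ℝ → ℝ := IccExtend hT ((Icc 0 T).domRestrict fun s => ω (φ s)) with hf_def
  have hf : Continuous f := hωφ.domRestrict.Icc_extend'
  have hf_eq : ∀ s ∈ Icc 0 T, f s = ω (φ s) := fun s hs => by
    rw [hf_def, IccExtend_of_mem hT _ hs]; rfl
  have hf_nonneg : ∀ s, 0 ≤ f s := fun s => by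
    have hm := (projIcc 0 T hT s).2
    have : ω 0 ≤ ω (φ (projIcc 0 T hT s)) :=
      hω.monotoneOn (mem_Ici.2 le_rfl) (h0 _ hm) (h0 _ hm)
    rw [hω.map_zero] at this
    exact this
  have hint : ∀ {x y : ℝ}, 0 < x → 0 < y → IntervalIntegrable (fun s => 1 / ω s) volume x y := by
    intro x y hx hy
    refine (hω.continuousOn_inv.mono fun s hs => ?_).intervalIntegrable
    exact (lt_min hx hy).trans_le hs.1
  -- The majorant `ψ = ε + C ∫ ω(φ)` satisfies `ψ' ≤ C ω(ψ)`, so `∫ 1/ω` from `ε` to `ψ t` grows at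
  -- rate at most `C`. The shift by `ε` keeps `ψ` where `1/ω` is continuous; the bound is uniform in
  -- `ε`, which contradicts the divergence at `0`.
  have key : ∀ ε, 0 < ε → ε < a → ∫ s in ε..a, 1 / ω s ≤ C * T := by
    intro ε hε hεa
    set ψ : ℝ → ℝ := fun t => ε + C * ∫ s in (0 : ℝ)..t, f s with hψ
    have hψ' : ∀ t, HasDerivAt ψ (C * f t) t := fun t =>
      (((hf.integral_hasStrictDerivAt 0 t).hasDerivAt).const_mul C).const_add ε
    have hψpos : ∀ t, 0 ≤ t → ε ≤ ψ t := fun t ht => by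
      have := intervalIntegral.integral_nonneg (μ := volume) ht (fun s _ => hf_nonneg s)
      have := mul_nonneg hC this
      simp only [hψ]; linarith
    have hφψ : ∀ t ∈ Icc 0 T, φ t ≤ ψ t := fun t ht => by
      have h1 : ∫ s in (0 : ℝ)..t, ω (φ s) = ∫ s in (0 : ℝ)..t, f s := by
        refine intervalIntegral.integral_congr fun s hs => ?_
        rw [uIcc_of_le ht.1] at hs
        exact (hf_eq s ⟨hs.1, hs.2.trans ht.2⟩).symm
      have := h t ht
      rw [h1] at this
      simp only [hψ]; linarith
    have hG : ∀ t ∈ Icc 0 T, HasDerivAt (fun t => ∫ s in ε..ψ t, 1 / ω s)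
        (1 / ω (ψ t) * (C * f t)) t := by
      intro t ht
      have hp : 0 < ψ t := hε.trans_le (hψpos t ht.1)
      have hn : Ioi (0 : ℝ) ∈ 𝓝 (ψ t) := Ioi_mem_nhds hp
      have := intervalIntegral.integral_hasDerivAt_right (hint hε hp)
        (hω.continuousOn_inv.stronglyMeasurableAtFilter isOpen_Ioi _ hp)
        (hω.continuousOn_inv.continuousAt hn)
      exact this.comp t (hψ' t)
    have hle := (convex_Icc 0 T).image_sub_le_mul_sub_of_deriv_le (C := C)
      (fun t ht => (hG t ht).continuousAt.continuousWithinAt)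
      (fun t ht => (hG t (interior_subset ht)).differentiableAt.differentiableWithinAt)
      (fun t ht => by
        have ht := interior_subset ht
        rw [(hG t ht).deriv, hf_eq t ht]
        have hp : 0 < ψ t := hε.trans_le (hψpos t ht.1)
        have hm : ω (φ t) ≤ ω (ψ t) := hω.monotoneOn (h0 t ht) hp.le (hφψ t ht)
        have hq := hω.pos _ hp
        rw [one_div_mul_eq_div, div_le_iff₀ hq]
        gcongr) 0 (left_mem_Icc.2 hT) T (right_mem_Icc.2 hT) hT
    have hψ0 : ψ 0 = ε := by simp [hψ]
    simp only [hψ0, intervalIntegral.integral_same, sub_zero] at hle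
    have haψ : a ≤ ψ T := hφψ T (right_mem_Icc.2 hT)
    have hpos : 0 < ψ T := ha.trans_le haψ
    rw [← intervalIntegral.integral_add_adjacent_intervals (hint hε ha) (hint ha hpos)] at hle
    have : 0 ≤ ∫ s in a..ψ T, 1 / ω s := intervalIntegral.integral_nonneg haψ fun s hs =>
      one_div_nonneg.2 (hω.pos s (ha.trans_le hs.1)).le
    linarith
  have hI : IntegrableOn (fun s => 1 / ω s) (Ioc 0 a) := by
    have hseq : Tendsto (fun n : ℕ => a / ((n : ℝ) + 2)) atTop (𝓝 0) :=
      tendsto_const_nhds.div_atTop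
        (tendsto_atTop_add_const_right _ _ tendsto_natCast_atTop_atTop)
    have hpos : ∀ n : ℕ, 0 < a / ((n : ℝ) + 2) := fun n => by positivity
    have hlt : ∀ n : ℕ, a / ((n : ℝ) + 2) < a := fun n => by
      rw [div_lt_iff₀ (by positivity)]
      have : (0 : ℝ) ≤ n := n.cast_nonneg
      nlinarith
    refine integrableOn_Ioc_of_intervalIntegral_norm_bounded_left (I := C * T) (l := atTop)
      (fun n => ?_) hseq (Eventually.of_forall fun n => ?_)
    · exact (intervalIntegrable_iff_integrableOn_Ioc_of_le (hlt n).le).1 (hint (hpos n) ha)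
    · refine le_trans (le_of_eq ?_) (key _ (hpos n) (hlt n))
      rw [intervalIntegral.integral_of_le (hlt n).le]
      refine setIntegral_congr_fun measurableSet_Ioc fun s hs => ?_
      exact Real.norm_of_nonneg (one_div_nonneg.2 (hω.pos s ((hpos n).trans hs.1)).le)
  have hI1 : IntegrableOn (fun s => 1 / ω s) (Ioc 0 1) := by
    rcases le_total 1 a with h1 | h1
    · exact hI.mono_set (Ioc_subset_Ioc_right h1)
    · rw [← Ioc_union_Ioc_eq_Ioc ha.le h1]
      exact hI.union ((intervalIntegrable_iff_integrableOn_Ioc_of_le h1).1 (hint ha one_pos))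
  have := hI1.lintegral_lt_top
  rw [hω.osgood] at this
  exact lt_irrefl _ this

/-- Trajectories of a field with modulus of continuity `C ω` are determined by their initial
position. -/
theorem IsTrajectory.eq_of_eq_zero {ω : ℝ → ℝ} (hω : IsOsgoodModulus ω) {u : ℝ → Torus → Plane}
    {C : ℝ} (hC : 0 ≤ C) (hu : ∀ t, 0 ≤ t → ∀ x y, ‖u t x - u t y‖ ≤ C * ω (dist x y))
    {γ γ' : ℝ → Torus} (h : IsTrajectory u γ) (h' : IsTrajectory u γ') (h0 : γ 0 = γ' 0) {T : ℝ}
    (hT : 0 ≤ T) : γ T = γ' T := by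
  obtain ⟨g, hg⟩ := h
  obtain ⟨g', hg'⟩ := h'
  have hproj : proj (g 0) = proj (g' 0) := by
    rw [← (hg 0 le_rfl).1, ← (hg' 0 le_rfl).1, h0]
  set F : ℝ → Plane := fun s => u s (proj (g s)) - u s (proj (g' s)) with hF
  have hdiff : ∀ t, 0 ≤ t → ∫ s in (0 : ℝ)..t, F s = g t - (g' t + (g 0 - g' 0)) := by
    intro t ht
    rw [hF, intervalIntegral.integral_sub (hg t ht).2.1 (hg' t ht).2.1]
    have e1 := (hg t ht).2.2
    have e2 := (hg' t ht).2.2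
    rw [e1, e2]
    abel
  have hIF : IntervalIntegrable F volume 0 T := (hg T hT).2.1.sub (hg' T hT).2.1
  -- The two lifts may start at different representatives of one point, so `g'` is first moved by
  -- the period `g 0 - g' 0`. The norm of the integral of `F` is then a continuous majorant of the
  -- distance, to which Osgood's lemma applies.
  have hdist : ∀ s, 0 ≤ s → dist (proj (g s)) (proj (g' s)) ≤ ‖∫ r in (0 : ℝ)..s, F r‖ := by
    intro s hs
    rw [hdiff s hs, ← proj_add_sub_of_eq hproj (g' s)]
    exact dist_proj_le _ _
  have hcont : ContinuousOn (fun t => ‖∫ s in (0 : ℝ)..t, F s‖) (Icc 0 T) := by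
    have := intervalIntegral.continuousOn_primitive_interval' hIF left_mem_uIcc
    rw [uIcc_of_le hT] at this
    exact this.norm
  have hzero := hω.eq_zero_of_le_integral hC hT hcont (fun _ _ => norm_nonneg _) fun t ht => by
    rw [← intervalIntegral.integral_const_mul]
    refine intervalIntegral.norm_integral_le_of_norm_le ht.1
      (Eventually.of_forall fun s hs => ?_) ?_
    · refine (hu s hs.1.le _ _).trans ?_
      gcongr
      exact hω.monotoneOn (mem_Ici.2 dist_nonneg) (mem_Ici.2 (norm_nonneg _)) (hdist s hs.1.le)
    · refine ContinuousOn.intervalIntegrable ?_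
      rw [uIcc_of_le ht.1]
      exact continuousOn_const.mul (hω.continuousOn.comp (hcont.mono (Icc_subset_Icc_right ht.2))
        fun _ _ => norm_nonneg _)
  have hd := hdist T hT
  rw [hzero] at hd
  rw [(hg T hT).1, (hg' T hT).1]
  exact dist_le_zero.1 hd

/-! ### Global integral curves of bounded Lipschitz fields -/

section ODE

variable {E : Type*} [NormedAddCommGroup E] [NormedSpace ℝ E] [CompleteSpace E]

open scoped NNReal in
-- The speed bound `M` keeps a solution within `M (n + 1)` of `x` on the interval of radius `n + 1`,
-- so Picard–Lindelöf applies on each such interval, and uniqueness glues the solutions.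
theorem exists_hasDerivAt_of_lipschitzWith {v : ℝ → E → E} {K M : ℝ≥0}
    (hv : ∀ t, LipschitzWith K (v t)) (hc : ∀ x, Continuous fun t => v t x)
    (hM : ∀ t x, ‖v t x‖ ≤ M) (t₀ : ℝ) (x : E) :
    ∃ g : ℝ → E, g t₀ = x ∧ ∀ t, HasDerivAt g (v t (g t)) t := by
  have hloc : ∀ n : ℕ, ∃ α : ℝ → E, α t₀ = x ∧
      ∀ t ∈ Ioo (t₀ - (n + 1)) (t₀ + (n + 1)), HasDerivAt α (v t (α t)) t := by
    intro n
    have hn : (0 : ℝ) < n + 1 := by positivity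
    have hpl : IsPicardLindelof v (tmin := t₀ - (n + 1)) (tmax := t₀ + (n + 1))
        ⟨t₀, by linarith, by linarith⟩ x (M * (n + 1)) 0 M K :=
      { lipschitzOnWith := fun t _ => (hv t).lipschitzOnWith
        continuousOn := fun y _ => (hc y).continuousOn
        norm_le := fun t _ y _ => hM t y
        mul_max_le := by simp }
    obtain ⟨α, h0, hα⟩ := hpl.exists_eq_forall_mem_Icc_hasDerivWithinAt₀
    exact ⟨α, h0, fun t ht => (hα t (Ioo_subset_Icc_self ht)).hasDerivAt (Icc_mem_nhds ht.1 ht.2)⟩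
  choose α h0 hα using hloc
  have hagree : ∀ k n : ℕ, k ≤ n → EqOn (α k) (α n) (Ioo (t₀ - (k + 1)) (t₀ + (k + 1))) := by
    intro k n hkn
    have hkn' : (k : ℝ) ≤ n := by exact_mod_cast hkn
    have hk : (0 : ℝ) < k + 1 := by positivity
    exact ODE_solution_unique_of_mem_Ioo (s := fun _ => univ)
      (fun t _ => (hv t).lipschitzOnWith) ⟨by linarith, by linarith⟩
      (fun t ht => ⟨hα k t ht, mem_univ _⟩)
      (fun t ht => ⟨hα n t ⟨by linarith [ht.1], by linarith [ht.2]⟩, mem_univ _⟩)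
      ((h0 k).trans (h0 n).symm)
  have hmem : ∀ s, s ∈ Ioo (t₀ - ((⌈|s - t₀|⌉₊ : ℝ) + 1)) (t₀ + ((⌈|s - t₀|⌉₊ : ℝ) + 1)) := by
    intro s
    have := abs_le.1 (Nat.le_ceil |s - t₀|)
    exact ⟨by linarith [this.1], by linarith [this.2]⟩
  refine ⟨fun t => α ⌈|t - t₀|⌉₊ t, by simp [h0], fun t => ?_⟩
  -- The extra `1` puts `t` strictly inside the interval of radius `n`, so one local solution
  -- represents the glued curve in a neighbourhood of `t`.
  set n := ⌈|t - t₀|⌉₊ + 1 with hn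
  have ht := hmem t
  have htn : t ∈ Ioo (t₀ - n) (t₀ + n) := by rw [hn]; push_cast; exact ht
  have hev : (fun t => α ⌈|t - t₀|⌉₊ t) =ᶠ[𝓝 t] α n := by
    filter_upwards [Ioo_mem_nhds htn.1 htn.2] with s hs
    refine hagree _ n (Nat.ceil_le.2 (abs_le.2 ⟨?_, ?_⟩)) (hmem s)
    · linarith [hs.1]
    · linarith [hs.2]
  have h2 := hα n t ⟨by linarith [htn.1], by linarith [htn.2]⟩
  rw [hev.hasDerivAt_iff]
  convert h2 using 2
  exact hev.eq_of_nhds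

end ODE

open scoped NNReal

/-! ### Plane fields of small support as fields on the torus -/

/-- The divergence of a plane field. -/
noncomputable def divergence (W : Plane → Plane) (p : Plane) : ℝ :=
  ∑ i : Fin 2, (fderiv ℝ W p (EuclideanSpace.single i 1)) i

/-- The field on the torus that agrees with `W` on the fundamental domain. -/
noncomputable def torusField (W : Plane → Plane) (x : Torus) : Plane := W (rep x)

section TorusField

variable {W : Plane → Plane} {r : ℝ}

theorem half_le_norm_coe {x : ℝ} (h1 : 1 ≤ |x|) (h2 : |x| < 3 / 2) :
    1 / 2 ≤ ‖(x : AddCircle (2 : ℝ))‖ := by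
  have hp : ((2 : ℝ) : AddCircle (2 : ℝ)) = 0 := AddCircle.coe_period 2
  rcases le_total 0 x with h | h
  · rw [abs_of_nonneg h] at h1 h2
    have e : (x : AddCircle (2 : ℝ)) = ((x - 2 : ℝ) : AddCircle (2 : ℝ)) := by
      rw [AddCircle.coe_sub, hp, sub_zero]
    have h3 : |x - 2| = 2 - x := by rw [abs_of_nonpos] <;> linarith
    rw [e, (AddCircle.norm_coe_eq_abs_iff (p := (2 : ℝ)) two_ne_zero).2] <;> rw [h3]
    · linarith
    · rw [abs_two]; linarith
  · rw [abs_of_nonpos h] at h1 h2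
    have e : (x : AddCircle (2 : ℝ)) = ((x + 2 : ℝ) : AddCircle (2 : ℝ)) := by
      rw [AddCircle.coe_add, hp, add_zero]
    have h3 : |x + 2| = x + 2 := abs_of_nonneg (by linarith)
    rw [e, (AddCircle.norm_coe_eq_abs_iff (p := (2 : ℝ)) two_ne_zero).2] <;> rw [h3]
    · linarith
    · rw [abs_two]; linarith

/-- If some `|q i|` lies in `[1, 3/2)`, then `q i` is at distance at least `1/2` from the even
integers, so both `q` and its representative lie outside the support of `W`. Otherwise `q` is its
own representative. -/
theorem torusField_proj (hr : r < 1 / 2) (hW : ∀ p, r < ‖p‖ → W p = 0) {q : Plane}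
    (hq : ∀ i, |q i| < 3 / 2) : torusField W (proj q) = W q := by
  by_cases h : ∀ i, |q i| < 1
  · rw [torusField, rep_proj fun i => ⟨(abs_lt.1 (h i)).1.le, (abs_lt.1 (h i)).2⟩]
  · push Not at h
    obtain ⟨i, hi⟩ := h
    have h1 : 1 / 2 ≤ ‖rep (proj q)‖ := calc
      1 / 2 ≤ ‖(q i : AddCircle (2 : ℝ))‖ := half_le_norm_coe hi (hq i)
      _ = ‖proj q i‖ := rfl
      _ ≤ ‖proj q‖ := PiLp.norm_apply_le _ i
      _ = ‖rep (proj q)‖ := (norm_rep _).symm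
    rw [torusField, hW _ (hr.trans_le h1), hW]
    linarith [abs_apply_le_norm q i]

/-- Locally the lifted field is a translate of `W` by a period, so smoothness, divergence and
derivative bounds pass to the torus without any discussion of the edges of the fundamental domain.
-/
theorem torusField_eventuallyEq (hr : r < 1 / 2) (hW : ∀ p, r < ‖p‖ → W p = 0) (v : Plane) :
    ∃ a, (fun p => torusField W (proj p)) =ᶠ[𝓝 v] fun p => W (p - a) := by
  refine ⟨v - rep (proj v), ?_⟩
  filter_upwards [Metric.ball_mem_nhds v (show (0 : ℝ) < 1 / 2 by norm_num)] with p hp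
  have e : proj p = proj (p - (v - rep (proj v))) := by
    rw [proj_sub, proj_sub, proj_rep, sub_self, sub_zero]
  rw [e]
  refine torusField_proj hr hW fun i => ?_
  rw [mem_ball_iff_norm] at hp
  have h1 := abs_apply_le_norm (p - v) i
  have h2 := rep_mem (proj v) i
  have e2 : (p - (v - rep (proj v))) i = (p - v) i + rep (proj v) i := by simp; ring
  rw [e2]
  refine (abs_add_le _ _).trans_lt ?_
  have : |rep (proj v) i| ≤ 1 := abs_le.2 ⟨h2.1, h2.2.le⟩
  linarith

theorem torusField_smooth (hr : r < 1 / 2) (hW : ∀ p, r < ‖p‖ → W p = 0)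
    (hs : ContDiff ℝ ((⊤ : ℕ∞) : WithTop ℕ∞) W) : IsSmooth (torusField W) := by
  refine contDiff_iff_contDiffAt.2 fun v => ?_
  obtain ⟨a, ha⟩ := torusField_eventuallyEq hr hW v
  exact ((hs.comp (contDiff_id.sub contDiff_const)).contDiffAt).congr_of_eventuallyEq ha

theorem torusField_divergence (hr : r < 1 / 2) (hW : ∀ p, r < ‖p‖ → W p = 0)
    (hd : ∀ p, divergence W p = 0) (v : Plane) :
    divergence (fun p => torusField W (proj p)) v = 0 := by
  obtain ⟨a, ha⟩ := torusField_eventuallyEq hr hW v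
  unfold divergence
  rw [ha.fderiv_eq, fderiv_comp_sub]
  exact hd _

theorem torusField_lipschitz (hr : r < 1 / 2) (hW : ∀ p, r < ‖p‖ → W p = 0)
    (hs : ContDiff ℝ ((⊤ : ℕ∞) : WithTop ℕ∞) W) {L : ℝ≥0} (hL : LipschitzWith L W) (x y : Torus) :
    ‖torusField W x - torusField W y‖ ≤ L * dist x y := by
  have h : LipschitzWith L fun p => torusField W (proj p) := by
    refine lipschitzWith_of_nnnorm_fderiv_le
      ((torusField_smooth hr hW hs).differentiable (by simp)) fun v => ?_
    obtain ⟨a, ha⟩ := torusField_eventuallyEq hr hW v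
    rw [ha.fderiv_eq]
    refine norm_fderiv_le_of_lipschitz ℝ ?_
    have := hL.comp ((IsometryEquiv.subRight a).isometry.lipschitz)
    rwa [mul_one] at this
  obtain ⟨v, w, rfl, rfl, hvw⟩ := exists_lifts x y
  rw [← hvw, ← dist_eq_norm, ← dist_eq_norm]
  exact h.dist_le_mul v w

end TorusField

/-! ### Rescaling -/

/-- The field `W` transported by the dilation of factor `ρ`. -/
noncomputable def rescale (ρ : ℝ) (W : Plane → Plane) (p : Plane) : Plane := ρ • W (ρ⁻¹ • p)

section Rescale

variable {W : Plane → Plane} {ρ : ℝ}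

theorem rescale_smooth (hs : ContDiff ℝ ((⊤ : ℕ∞) : WithTop ℕ∞) W) :
    ContDiff ℝ ((⊤ : ℕ∞) : WithTop ℕ∞) (rescale ρ W) :=
  (hs.comp (contDiff_id.const_smul ρ⁻¹)).const_smul ρ

/-- The scale invariance behind the construction: the factors `ρ` and `ρ⁻¹` cancel in the Lipschitz
constant, whereas the amplitude decays with `ρ`. -/
theorem rescale_lipschitz (hρ : 0 < ρ) {L : ℝ≥0} (hL : LipschitzWith L W) :
    LipschitzWith L (rescale ρ W) := by
  refine LipschitzWith.of_dist_le_mul fun p q => ?_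
  have h := hL.dist_le_mul (ρ⁻¹ • p) (ρ⁻¹ • q)
  rw [dist_smul₀, Real.norm_of_nonneg (inv_nonneg.2 hρ.le)] at h
  rw [rescale, rescale, dist_smul₀, Real.norm_of_nonneg hρ.le]
  calc ρ * dist (W (ρ⁻¹ • p)) (W (ρ⁻¹ • q)) ≤ ρ * (L * (ρ⁻¹ * dist p q)) := by gcongr
    _ = L * dist p q := by field_simp

theorem rescale_divergence (hρ : 0 < ρ) (hs : ContDiff ℝ ((⊤ : ℕ∞) : WithTop ℕ∞) W)
    (hd : ∀ p, divergence W p = 0) (p : Plane) : divergence (rescale ρ W) p = 0 := by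
  have hW : HasFDerivAt W (fderiv ℝ W (ρ⁻¹ • p)) (ρ⁻¹ • p) :=
    (hs.differentiable (by simp) _).hasFDerivAt
  have h1 : HasFDerivAt (fun q : Plane => ρ⁻¹ • q) (ρ⁻¹ • ContinuousLinearMap.id ℝ Plane) p :=
    (hasFDerivAt_id p).const_smul ρ⁻¹
  have h2 : HasFDerivAt (rescale ρ W)
      (ρ • (fderiv ℝ W (ρ⁻¹ • p)).comp (ρ⁻¹ • ContinuousLinearMap.id ℝ Plane)) p :=
    (hW.comp p h1).const_smul ρ
  have h3 : ρ • (fderiv ℝ W (ρ⁻¹ • p)).comp (ρ⁻¹ • ContinuousLinearMap.id ℝ Plane)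
      = fderiv ℝ W (ρ⁻¹ • p) := by
    ext1 v
    simp [smul_smul, hρ.ne']
  rw [h3] at h2
  unfold divergence
  rw [h2.fderiv]
  exact hd _

theorem rescale_eq_zero (hρ : 0 < ρ) {R : ℝ} (hW : ∀ p, R < ‖p‖ → W p = 0) (p : Plane)
    (hp : ρ * R < ‖p‖) : rescale ρ W p = 0 := by
  rw [rescale, hW, smul_zero]
  rw [norm_smul, Real.norm_of_nonneg (inv_nonneg.2 hρ.le), inv_mul_eq_div, lt_div_iff₀ hρ, mul_comm]
  exact hp

theorem rescale_smul (hρ : 0 < ρ) (p : Plane) : rescale ρ W (ρ • p) = ρ • W p := by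
  rw [rescale, smul_smul, inv_mul_cancel₀ hρ.ne', one_smul]

end Rescale

/-! ### Hamiltonian fields -/

/-- The Hamiltonian field `(∂₁ H, -∂₀ H)`. -/
noncomputable def hamField (H : Plane → ℝ) (p : Plane) : Plane :=
  !₂[fderiv ℝ H p (EuclideanSpace.single 1 1), -fderiv ℝ H p (EuclideanSpace.single 0 1)]

section HamField

variable {H : Plane → ℝ}

theorem hamField_smooth (hH : ContDiff ℝ ((⊤ : ℕ∞) : WithTop ℕ∞) H) :
    ContDiff ℝ ((⊤ : ℕ∞) : WithTop ℕ∞) (hamField H) := by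
  have h : ∀ v, ContDiff ℝ ((⊤ : ℕ∞) : WithTop ℕ∞) fun p => fderiv ℝ H p v := fun v =>
    (hH.fderiv_right (m := ((⊤ : ℕ∞) : WithTop ℕ∞)) le_rfl).clm_apply contDiff_const
  refine contDiff_euclidean.2 fun i => ?_
  fin_cases i
  · exact h _
  · exact (h _).neg

/-- The divergence is a difference of mixed second derivatives of `H`, which cancel by symmetry. -/
theorem hamField_divergence (hH : ContDiff ℝ ((⊤ : ℕ∞) : WithTop ℕ∞) H) (p : Plane) :
    divergence (hamField H) p = 0 := by
  have hd : DifferentiableAt ℝ (hamField H) p := (hamField_smooth hH).differentiable (by simp) p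
  have hf : DifferentiableAt ℝ (fderiv ℝ H) p :=
    (hH.fderiv_right (m := ((⊤ : ℕ∞) : WithTop ℕ∞)) le_rfl).differentiable (by simp) p
  have hi : ∀ (i : Fin 2) (w : Plane),
      (fderiv ℝ (hamField H) p w) i = fderiv ℝ (fun q => hamField H q i) p w := fun i w => by
    have := ((EuclideanSpace.proj (𝕜 := ℝ) i).hasFDerivAt.comp p hd.hasFDerivAt).fderiv
    exact (DFunLike.congr_fun this w).symm
  have h0 : ∀ v w : Plane, fderiv ℝ (fun q => fderiv ℝ H q v) p w = fderiv ℝ (fderiv ℝ H) p w v :=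
    fun v w => by
      have := (hf.hasFDerivAt.clm_apply (hasFDerivAt_const v p)).fderiv
      rw [this]; simp
  have hsymm := (hH.contDiffAt (x := p)).isSymmSndFDerivAt
    (by rw [minSmoothness_of_isRCLikeNormedField]; exact WithTop.coe_le_coe.2 le_top)
  unfold divergence
  rw [Fin.sum_univ_two, hi, hi]
  have e0 : (fun q => hamField H q 0) = fun q => fderiv ℝ H q (EuclideanSpace.single 1 1) := rfl
  have e1 : (fun q => hamField H q 1) = fun q => -fderiv ℝ H q (EuclideanSpace.single 0 1) := rfl
  rw [e0, e1, fderiv_fun_neg, neg_apply, h0, h0, hsymm.eq, add_neg_cancel]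

theorem hamField_congr {H' : Plane → ℝ} {p : Plane} (h : H =ᶠ[𝓝 p] H') :
    hamField H p = hamField H' p := by
  unfold hamField
  rw [h.fderiv_eq]

theorem hamField_apply_zero {f : ℝ → ℝ} {f' : ℝ} {p : Plane} (hf : HasDerivAt f f' (p 0)) :
    hamField (fun q => f (q 0)) p = !₂[0, -f'] := by
  have h := (hf.comp_hasFDerivAt p (EuclideanSpace.proj (𝕜 := ℝ) (0 : Fin 2)).hasFDerivAt).fderiv
  have e : (f ∘ fun q : Plane => (EuclideanSpace.proj (𝕜 := ℝ) (0 : Fin 2)) q)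
    = fun q : Plane => f (q 0) := rfl
  rw [← e, hamField, h]
  simp

theorem hamField_apply_one {f : ℝ → ℝ} {f' : ℝ} {p : Plane} (hf : HasDerivAt f f' (p 1)) :
    hamField (fun q => f (q 1)) p = !₂[f', 0] := by
  have h := (hf.comp_hasFDerivAt p (EuclideanSpace.proj (𝕜 := ℝ) (1 : Fin 2)).hasFDerivAt).fderiv
  have e : (f ∘ fun q : Plane => (EuclideanSpace.proj (𝕜 := ℝ) (1 : Fin 2)) q)
    = fun q : Plane => f (q 1) := rfl
  rw [← e, hamField, h]
  simp

end HamField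

/-- Smooth incompressible fields with `ω`-norm at most `ε` and support in the ball of radius `r`. -/
structure IsBlockField (ω : ℝ → ℝ) (ε r : ℝ) (F : Torus → Plane) : Prop where
  smooth : IsSmooth F
  divergence_eq_zero : ∀ v, divergence (fun p => F (proj p)) v = 0
  omegaNorm_le : omegaNorm ω F ≤ ENNReal.ofReal ε
  eq_zero : ∀ x, r < ‖x‖ → F x = 0
  lipschitz : ∃ L : ℝ≥0, ∀ x y, ‖F x - F y‖ ≤ L * dist x y

/-- Dilating a compactly supported field makes its `ω`-norm small. -/
theorem exists_isBlockField_rescale {ω : ℝ → ℝ} (hω : IsOsgoodModulus ω) {W : Plane → Plane} {R : ℝ}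
    (hR : 0 < R) (hs : ContDiff ℝ ((⊤ : ℕ∞) : WithTop ℕ∞) W) (hd : ∀ p, divergence W p = 0)
    (hW : ∀ p, R < ‖p‖ → W p = 0) {ε r : ℝ} (hε : 0 < ε) (hr : 0 < r) (hr2 : r < 1 / 2) :
    ∃ ρ₀ > 0, ∀ ρ, 0 < ρ → ρ ≤ ρ₀ → IsBlockField ω ε r (torusField (rescale ρ W)) := by
  have hcs : HasCompactSupport W :=
    HasCompactSupport.intro (isCompact_closedBall 0 R) fun p hp =>
      hW p (by simpa using hp)
  obtain ⟨L, hL⟩ := hs.lipschitzWith_of_hasCompactSupport hcs (by simp)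
  obtain ⟨M, hM⟩ := hs.continuous.bounded_above_of_compact_support hcs
  have hM0 : 0 ≤ M := (norm_nonneg _).trans (hM 0)
  obtain ⟨η, hη, hsmall⟩ := exists_forall_omegaNorm_le hω L.2 hε
  -- The first bound puts the support in the ball of radius `r`, the second brings the amplitude
  -- below `η`. The threshold `η` depends only on `L` and `ε`, so it can be fixed before `ρ`.
  refine ⟨min (r / R) (η / (M + 1)), by positivity, fun ρ hρ hρ0 => ?_⟩
  have h1 : ρ * R ≤ r := (le_div_iff₀ hR).1 (hρ0.trans (min_le_left _ _))
  have h2 : ρ * (M + 1) ≤ η := (le_div_iff₀ (by positivity)).1 (hρ0.trans (min_le_right _ _))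
  have hz : ∀ p, r < ‖p‖ → rescale ρ W p = 0 := fun p hp =>
    rescale_eq_zero hρ hW p (h1.trans_lt hp)
  have hlip := torusField_lipschitz hr2 hz (rescale_smooth hs) (rescale_lipschitz hρ hL)
  exact
    { smooth := torusField_smooth hr2 hz (rescale_smooth hs)
      divergence_eq_zero := torusField_divergence hr2 hz (rescale_divergence hρ hs hd)
      omegaNorm_le := hsmall _ hlip fun x => by
        rw [torusField, rescale, norm_smul, Real.norm_of_nonneg hρ.le]
        have := hM (ρ⁻¹ • rep x)
        calc ρ * ‖W (ρ⁻¹ • rep x)‖ ≤ ρ * (M + 1) := by gcongr; linarith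
          _ ≤ η := h2
      eq_zero := fun x hx => hz _ (by rwa [norm_rep])
      lipschitz := ⟨L, hlip⟩ }

/-! ### The two shears -/

/-- Two compactly supported incompressible plane fields. In a large ball the first is the horizontal
shear `(x, y) ↦ (y, 0)`, and near the line `x = j` the second is the vertical shear
`(x, y) ↦ (0, A (x - j))`. -/
theorem exists_shear_fields (m : ℕ) (A R : ℝ) (hR : 0 < R) :
    ∃ W₁ W₂ : Plane → Plane,
      (ContDiff ℝ ((⊤ : ℕ∞) : WithTop ℕ∞) W₁ ∧ ContDiff ℝ ((⊤ : ℕ∞) : WithTop ℕ∞) W₂) ∧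
      (∀ p, divergence W₁ p = 0 ∧ divergence W₂ p = 0) ∧
      (∀ p, R + 1 < ‖p‖ → W₁ p = 0 ∧ W₂ p = 0) ∧
      (∀ p, ‖p‖ < R → W₁ p = !₂[p 1, 0]) ∧
      ∀ p, ‖p‖ < R → ∀ j : Fin m, |p 0 - ((j : ℕ) : ℝ)| < 1 / 4 →
        W₂ p = !₂[0, A * (p 0 - ((j : ℕ) : ℝ))] := by
  let χ : ContDiffBump (0 : Plane) := ⟨R, R + 1, hR, by linarith⟩
  let ψ : ContDiffBump (0 : ℝ) := ⟨1 / 4, 1 / 2, by norm_num, by norm_num⟩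
  have hχs : ContDiff ℝ ((⊤ : ℕ∞) : WithTop ℕ∞) (χ : Plane → ℝ) := χ.contDiff
  have hψs : ContDiff ℝ ((⊤ : ℕ∞) : WithTop ℕ∞) (ψ : ℝ → ℝ) := ψ.contDiff
  have hcoord : ∀ i : Fin 2, ContDiff ℝ ((⊤ : ℕ∞) : WithTop ℕ∞) fun p : Plane => p i := fun i =>
    (EuclideanSpace.proj (𝕜 := ℝ) i).contDiff
  have hχ1 : ∀ p, ‖p‖ < R → ∀ᶠ q in 𝓝 p, χ q = 1 := fun p hp => by
    have := χ.eventuallyEq_one_of_mem_ball (x := p) (by simpa [χ] using hp)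
    exact this
  have hχ0 : ∀ p, R + 1 < ‖p‖ → ∀ᶠ q in 𝓝 p, χ q = 0 := fun p hp => by
    have : {q : Plane | R + 1 < ‖q‖} ∈ 𝓝 p := (isOpen_lt continuous_const continuous_norm).mem_nhds hp
    filter_upwards [this] with q hq
    exact χ.zero_of_le_dist (by simpa [χ] using (show R + 1 < ‖q‖ from hq).le)
  have hzero : ∀ (H : Plane → ℝ) p, (∀ᶠ q in 𝓝 p, χ q = 0) → hamField (fun q => χ q * H q) p = 0 := by
    intro H p hp
    have : (fun q => χ q * H q) =ᶠ[𝓝 p] fun q => (fun _ : ℝ => (0 : ℝ)) (q 0) := by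
      filter_upwards [hp] with q hq
      simp [hq]
    rw [hamField_congr this, hamField_apply_zero (hasDerivAt_const _ _)]
    ext i; fin_cases i <;> simp
  set H₁ : Plane → ℝ := fun p => χ p * (p 1 ^ 2 / 2)
  -- The cut-offs around the integers equal `1` within distance `1/4` and vanish beyond `1/2`;
  -- within `1/4` of `j` every other `k` is at distance at least `3/4`, so a single quadratic term
  -- survives.
  set H₂ : Plane → ℝ := fun p =>
    χ p * ∑ j : Fin m, -(A / 2) * (p 0 - (j : ℝ)) ^ 2 * ψ (p 0 - (j : ℝ))
  have hH₁ : ContDiff ℝ ((⊤ : ℕ∞) : WithTop ℕ∞) H₁ :=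
    hχs.mul (((hcoord 1).pow 2).div_const 2)
  have hH₂ : ContDiff ℝ ((⊤ : ℕ∞) : WithTop ℕ∞) H₂ :=
    hχs.mul (ContDiff.sum fun j _ => (contDiff_const.mul
      (((hcoord 0).sub contDiff_const).pow 2)).mul (hψs.comp ((hcoord 0).sub contDiff_const)))
  refine ⟨hamField H₁, hamField H₂, ⟨hamField_smooth hH₁, hamField_smooth hH₂⟩,
    fun p => ⟨hamField_divergence hH₁ p, hamField_divergence hH₂ p⟩,
    fun p hp => ⟨hzero _ p (hχ0 p hp), hzero _ p (hχ0 p hp)⟩, fun p hp => ?_, fun p hp j hj => ?_⟩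
  · have h : H₁ =ᶠ[𝓝 p] fun q => (fun y : ℝ => y ^ 2 / 2) (q 1) := by
      filter_upwards [hχ1 p hp] with q hq
      simp [H₁, hq]
    have hd : ∀ y : ℝ, HasDerivAt (fun y : ℝ => y ^ 2 / 2) y y := fun y => by
      simpa using ((hasDerivAt_id' y).fun_pow 2).div_const 2
    rw [hamField_congr h, hamField_apply_one (hd _)]
  · have hnear : ∀ᶠ q : Plane in 𝓝 p, |q 0 - (j : ℝ)| < 1 / 4 :=
      (((hcoord 0).continuous.sub continuous_const).abs).continuousAt.eventually_lt
        continuousAt_const hj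
    have h : H₂ =ᶠ[𝓝 p] fun q => (fun x : ℝ => -(A / 2) * (x - (j : ℝ)) ^ 2) (q 0) := by
      filter_upwards [hχ1 p hp, hnear] with q hq hqj
      simp only [H₂, hq, one_mul]
      rw [Finset.sum_eq_single j]
      · rw [ψ.one_of_mem_closedBall, mul_one]
        simpa [ψ] using hqj.le
      · intro k _ hkj
        rw [ψ.zero_of_le_dist, mul_zero]
        have h1 : (1 : ℝ) ≤ |(j : ℝ) - (k : ℝ)| := by
          have : (1 : ℤ) ≤ |((j : ℕ) : ℤ) - ((k : ℕ) : ℤ)| :=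
            Int.one_le_abs (sub_ne_zero.2 fun e => hkj (Fin.ext (by exact_mod_cast e.symm)))
          exact_mod_cast this
        have h2 : |(j : ℝ) - (k : ℝ)| ≤ |q 0 - (j : ℝ)| + |q 0 - (k : ℝ)| := by
          have := abs_sub (q 0 - (k : ℝ)) (q 0 - (j : ℝ))
          rw [show q 0 - (k : ℝ) - (q 0 - (j : ℝ)) = (j : ℝ) - k by ring] at this
          linarith
        simp only [ψ, Real.dist_eq, sub_zero]
        linarith
      · simp
    have hd : ∀ x : ℝ, HasDerivAt (fun x : ℝ => -(A / 2) * (x - (j : ℝ)) ^ 2)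
        (-(A * (x - (j : ℝ)))) x := fun x => by
      have := (((hasDerivAt_id' x).sub_const (j : ℝ)).fun_pow 2).const_mul (-(A / 2))
      have e : -(A * (x - (j : ℝ))) = -(A / 2) * ((2 : ℕ) * (x - (j : ℝ)) ^ (2 - 1) * 1) := by
        norm_num; ring
      rwa [e]
    rw [hamField_congr h, hamField_apply_zero (hd _), neg_neg]

/-! ### Periodic orbits with prescribed itineraries -/

/-- The second order recurrence that governs the composition of the two shears has a periodic
solution close to every periodic word. -/
theorem exists_periodic_solution {m : ℕ} (hm : 0 < m) {n : ℕ} [NeZero n] (w : ZMod n → Fin m) :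
    ∃ x : ZMod n → ℝ, (∀ k, |x k| ≤ 2 * m) ∧ (∀ k, |x k - (w k : ℕ)| ≤ 1 / 8) ∧
      ∀ k, x (k + 1) - 2 * x k + x (k - 1) = 64 * m * (x k - (w k : ℕ)) := by
  have hm1 : (1 : ℝ) ≤ m := by exact_mod_cast hm
  have hA : (0 : ℝ) < 64 * m := by positivity
  -- The recurrence is solved for its undifferenced term. A second difference is at most four times
  -- the sup norm, so division by `64 m` makes `Φ` a contraction; with `‖x‖ ≤ 2 m` it also gives the
  -- error `8 m / (64 m) = 1/8`.
  let Φ : (ZMod n → ℝ) → ZMod n → ℝ := fun x k =>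
    (w k : ℕ) + (x (k + 1) - 2 * x k + x (k - 1)) / (64 * m)
  have hbound : ∀ z : ZMod n → ℝ, ∀ k,
      |(z (k + 1) - 2 * z k + z (k - 1)) / (64 * m)| ≤ 4 * ‖z‖ / (64 * m) := fun z k => by
    rw [abs_div, abs_of_pos hA]
    gcongr
    have h1 := norm_le_pi_norm z (k + 1)
    have h2 := norm_le_pi_norm z k
    have h3 := norm_le_pi_norm z (k - 1)
    rw [Real.norm_eq_abs, abs_le] at h1 h2 h3
    exact abs_le.2 ⟨by linarith [h1.1, h2.2, h3.1], by linarith [h1.2, h2.1, h3.2]⟩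
  have hΦ : ContractingWith (1 / 2) Φ := by
    refine ⟨by norm_num, LipschitzWith.of_dist_le_mul fun x y => ?_⟩
    refine (dist_pi_le_iff (by positivity)).2 fun k => ?_
    have e : Φ x k - Φ y k =
        ((x - y) (k + 1) - 2 * (x - y) k + (x - y) (k - 1)) / (64 * m) := by
      simp only [Φ, Pi.sub_apply]; ring
    rw [Real.dist_eq, e]
    refine (hbound _ k).trans ?_
    rw [dist_eq_norm, div_le_iff₀ hA]
    push_cast
    nlinarith [norm_nonneg (x - y)]
  obtain ⟨x, hx⟩ : ∃ x, Φ x = x := ⟨_, hΦ.fixedPoint_isFixedPt⟩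
  have hxk : ∀ k, x k = (w k : ℕ) + (x (k + 1) - 2 * x k + x (k - 1)) / (64 * m) := fun k =>
    (congrFun hx k).symm
  have hw : ∀ k, ((w k : ℕ) : ℝ) ≤ m := fun k => by exact_mod_cast (w k).2.le
  have hnorm : ‖x‖ ≤ m + 4 * ‖x‖ / (64 * m) := by
    refine (pi_norm_le_iff_of_nonneg (by positivity)).2 fun k => ?_
    rw [hxk k, Real.norm_eq_abs]
    refine (abs_add_le _ _).trans (add_le_add ?_ (hbound x k))
    rw [abs_of_nonneg (by positivity)]
    exact hw k
  have hnorm2 : ‖x‖ ≤ 2 * m := by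
    have : 4 * ‖x‖ / (64 * m) ≤ ‖x‖ / 16 := by
      rw [div_le_div_iff₀ hA (by norm_num)]
      nlinarith [norm_nonneg x]
    linarith
  refine ⟨x, fun k => (norm_le_pi_norm x k).trans hnorm2, fun k => ?_, fun k => ?_⟩
  · have h := hbound x k
    have e : x k - (w k : ℕ) = (x (k + 1) - 2 * x k + x (k - 1)) / (64 * m) := by
      linarith [hxk k]
    rw [e]
    refine h.trans ?_
    rw [div_le_div_iff₀ hA (by norm_num)]
    linarith
  · have e : x k - (w k : ℕ) = (x (k + 1) - 2 * x k + x (k - 1)) / (64 * m) := by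
      linarith [hxk k]
    rw [e]
    field_simp

/-! ### Time profiles -/

section Profile

/-- The first half of the time interval. -/
noncomputable def firstRamp (t : ℝ) : ℝ := Real.smoothTransition (2 * t)

/-- The second half of the time interval. -/
noncomputable def secondRamp (t : ℝ) : ℝ := Real.smoothTransition (2 * t - 1)

theorem firstRamp_smooth : ContDiff ℝ ((⊤ : ℕ∞) : WithTop ℕ∞) firstRamp :=
  Real.smoothTransition.contDiff.comp (contDiff_const.mul contDiff_id)

theorem secondRamp_smooth : ContDiff ℝ ((⊤ : ℕ∞) : WithTop ℕ∞) secondRamp :=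
  Real.smoothTransition.contDiff.comp ((contDiff_const.mul contDiff_id).sub contDiff_const)

theorem deriv_smooth {θ : ℝ → ℝ} (h : ContDiff ℝ ((⊤ : ℕ∞) : WithTop ℕ∞) θ) :
    ContDiff ℝ ((⊤ : ℕ∞) : WithTop ℕ∞) (deriv θ) :=
  (contDiff_infty_iff_deriv.1 h).2

theorem firstRamp_of_le {t : ℝ} (h : t ≤ 0) : firstRamp t = 0 :=
  Real.smoothTransition.zero_of_nonpos (by linarith)

theorem firstRamp_of_ge {t : ℝ} (h : 1 / 2 ≤ t) : firstRamp t = 1 :=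
  Real.smoothTransition.one_of_one_le (by linarith)

theorem secondRamp_of_le {t : ℝ} (h : t ≤ 1 / 2) : secondRamp t = 0 :=
  Real.smoothTransition.zero_of_nonpos (by linarith)

theorem secondRamp_of_ge {t : ℝ} (h : 1 ≤ t) : secondRamp t = 1 :=
  Real.smoothTransition.one_of_one_le (by linarith)

/-- Where a ramp takes its least or greatest value it has an extremum, so its derivative vanishes
even at the ends of its flat parts. -/
theorem deriv_eq_zero_of_extremal {θ : ℝ → ℝ} {a b : ℝ} (h : ∀ s, a ≤ θ s ∧ θ s ≤ b) {t : ℝ}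
    (ht : θ t = a ∨ θ t = b) : deriv θ t = 0 := by
  rcases ht with ht | ht
  · exact IsLocalMin.deriv_eq_zero (Eventually.of_forall fun s => ht ▸ (h s).1)
  · exact IsLocalMax.deriv_eq_zero (Eventually.of_forall fun s => ht ▸ (h s).2)

theorem firstRamp_mem (s : ℝ) : 0 ≤ firstRamp s ∧ firstRamp s ≤ 1 :=
  ⟨Real.smoothTransition.nonneg _, Real.smoothTransition.le_one _⟩

theorem secondRamp_mem (s : ℝ) : 0 ≤ secondRamp s ∧ secondRamp s ≤ 1 :=
  ⟨Real.smoothTransition.nonneg _, Real.smoothTransition.le_one _⟩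

theorem deriv_firstRamp_of_le {t : ℝ} (h : t ≤ 0) : deriv firstRamp t = 0 :=
  deriv_eq_zero_of_extremal firstRamp_mem (.inl (firstRamp_of_le h))

theorem deriv_firstRamp_of_ge {t : ℝ} (h : 1 / 2 ≤ t) : deriv firstRamp t = 0 :=
  deriv_eq_zero_of_extremal firstRamp_mem (.inr (firstRamp_of_ge h))

theorem deriv_secondRamp_of_le {t : ℝ} (h : t ≤ 1 / 2) : deriv secondRamp t = 0 :=
  deriv_eq_zero_of_extremal secondRamp_mem (.inl (secondRamp_of_le h))

theorem deriv_secondRamp_of_ge {t : ℝ} (h : 1 ≤ t) : deriv secondRamp t = 0 :=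
  deriv_eq_zero_of_extremal secondRamp_mem (.inr (secondRamp_of_ge h))

end Profile

/-! ### The flow of a block -/

/-- The field that runs `F₁` in the first half of the time interval and `F₂` in the second. -/
noncomputable def blockField (F₁ F₂ : Torus → Plane) (t : ℝ) : Torus → Plane :=
  deriv firstRamp t • F₁ + deriv secondRamp t • F₂

/-- The derivative vanishes at both ends of `[0, 1]`, so the periodic extension has no jump at the
integers and classical solutions exist for all times. -/
theorem continuous_deriv_firstRamp_fract : Continuous fun t : ℝ => deriv firstRamp (Int.fract t) :=
  ((deriv_smooth firstRamp_smooth).continuous.continuousOn).comp_fract''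
    (by rw [deriv_firstRamp_of_le le_rfl, deriv_firstRamp_of_ge (by norm_num)])

theorem continuous_deriv_secondRamp_fract :
    Continuous fun t : ℝ => deriv secondRamp (Int.fract t) :=
  ((deriv_smooth secondRamp_smooth).continuous.continuousOn).comp_fract''
    (by rw [deriv_secondRamp_of_le (by norm_num), deriv_secondRamp_of_ge le_rfl])

theorem exists_profile_bound :
    ∃ A : ℝ≥0, 0 < A ∧ ∀ t ∈ Icc (0 : ℝ) 1, |deriv firstRamp t| + |deriv secondRamp t| ≤ A := by
  obtain ⟨A, hA⟩ := isCompact_Icc.exists_bound_of_continuousOn (s := Icc (0 : ℝ) 1)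
    (f := fun t => |deriv firstRamp t| + |deriv secondRamp t|)
    ((deriv_smooth firstRamp_smooth).continuous.abs.add
      (deriv_smooth secondRamp_smooth).continuous.abs).continuousOn
  refine ⟨A.toNNReal + 1, by positivity, fun t ht => ?_⟩
  have h := (le_abs_self _).trans (hA t ht)
  have := Real.le_coe_toNNReal A
  push_cast
  linarith

theorem fract_mem_Icc (t : ℝ) : Int.fract t ∈ Icc (0 : ℝ) 1 :=
  ⟨Int.fract_nonneg t, (Int.fract_lt_one t).le⟩

theorem blockField_apply (F₁ F₂ : Torus → Plane) (t : ℝ) (x : Torus) :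
    blockField F₁ F₂ t x = deriv firstRamp t • F₁ x + deriv secondRamp t • F₂ x := rfl

theorem norm_smul_add_smul_le {a b : ℝ} {v w : Plane} {A M : ℝ} (hab : |a| + |b| ≤ A)
    (hv : ‖v‖ ≤ M) (hw : ‖w‖ ≤ M) (hM : 0 ≤ M) : ‖a • v + b • w‖ ≤ A * M := by
  calc ‖a • v + b • w‖ ≤ |a| * ‖v‖ + |b| * ‖w‖ := by
        refine (norm_add_le _ _).trans ?_
        rw [norm_smul, norm_smul, Real.norm_eq_abs, Real.norm_eq_abs]
    _ ≤ |a| * M + |b| * M := by gcongr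
    _ = (|a| + |b|) * M := by ring
    _ ≤ A * M := by gcongr

section BlockFlow

variable {ω : ℝ → ℝ} {ε r : ℝ} {F F₁ F₂ : Torus → Plane}

theorem IsBlockField.norm_le (hε : 0 ≤ ε) (h : IsBlockField ω ε r F) (x : Torus) : ‖F x‖ ≤ ε := by
  have h1 : ENNReal.ofReal ‖F x‖ ≤ ENNReal.ofReal ε :=
    ((le_iSup (fun x => ENNReal.ofReal ‖F x‖) x).trans le_self_add).trans h.omegaNorm_le
  exact (ENNReal.ofReal_le_ofReal_iff hε).1 h1

theorem IsBlockField.lipschitzWith (h : IsBlockField ω ε r F) :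
    ∃ L : ℝ≥0, LipschitzWith L fun p => F (proj p) := by
  obtain ⟨L, hL⟩ := h.lipschitz
  refine ⟨L, LipschitzWith.of_dist_le_mul fun p q => ?_⟩
  rw [dist_eq_norm, dist_eq_norm]
  exact (hL _ _).trans (by gcongr; exact dist_proj_le p q)

/-- The lift of the periodic extension of a block. -/
noncomputable def liftField (F₁ F₂ : Torus → Plane) (t : ℝ) (p : Plane) : Plane :=
  periodize (blockField F₁ F₂) t (proj p)

theorem liftField_apply (F₁ F₂ : Torus → Plane) (t : ℝ) (p : Plane) :
    liftField F₁ F₂ t p = deriv firstRamp (Int.fract t) • F₁ (proj p) +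
      deriv secondRamp (Int.fract t) • F₂ (proj p) := rfl

theorem liftField_lipschitz (h₁ : IsBlockField ω ε r F₁) (h₂ : IsBlockField ω ε r F₂) :
    ∃ K : ℝ≥0, ∀ t, LipschitzWith K (liftField F₁ F₂ t) := by
  obtain ⟨A, -, hA⟩ := exists_profile_bound
  obtain ⟨L₁, hL₁⟩ := h₁.lipschitzWith
  obtain ⟨L₂, hL₂⟩ := h₂.lipschitzWith
  refine ⟨A * (L₁ + L₂), fun t => LipschitzWith.of_dist_le_mul fun p q => ?_⟩
  have e : liftField F₁ F₂ t p - liftField F₁ F₂ t q =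
      deriv firstRamp (Int.fract t) • (F₁ (proj p) - F₁ (proj q)) +
      deriv secondRamp (Int.fract t) • (F₂ (proj p) - F₂ (proj q)) := by
    rw [liftField_apply, liftField_apply, smul_sub, smul_sub]; abel
  have h1 := hL₁.dist_le_mul p q
  have h2 := hL₂.dist_le_mul p q
  rw [dist_eq_norm] at h1 h2
  rw [dist_eq_norm, e]
  push_cast
  rw [mul_assoc]
  have : 0 ≤ L₁ * dist p q := by positivity
  have : 0 ≤ L₂ * dist p q := by positivity
  exact norm_smul_add_smul_le (hA _ (fract_mem_Icc t)) (by linarith) (by linarith) (by positivity)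

theorem liftField_continuous_comp (h₁ : IsBlockField ω ε r F₁) (h₂ : IsBlockField ω ε r F₂)
    {g : ℝ → Plane} (hg : Continuous g) : Continuous fun t => liftField F₁ F₂ t (g t) := by
  obtain ⟨L₁, hL₁⟩ := h₁.lipschitzWith
  obtain ⟨L₂, hL₂⟩ := h₂.lipschitzWith
  exact (continuous_deriv_firstRamp_fract.smul (hL₁.continuous.comp hg)).add
    (continuous_deriv_secondRamp_fract.smul (hL₂.continuous.comp hg))

theorem exists_lift_solution (hε : 0 ≤ ε) (h₁ : IsBlockField ω ε r F₁) (h₂ : IsBlockField ω ε r F₂)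
    (t₀ : ℝ) (p : Plane) :
    ∃ g : ℝ → Plane, g t₀ = p ∧ ∀ t, HasDerivAt g (liftField F₁ F₂ t (g t)) t := by
  obtain ⟨A, -, hA⟩ := exists_profile_bound
  obtain ⟨K, hK⟩ := liftField_lipschitz h₁ h₂
  refine exists_hasDerivAt_of_lipschitzWith (M := A * ε.toNNReal) hK
    (fun x => liftField_continuous_comp h₁ h₂ continuous_const) (fun t x => ?_) t₀ p
  push_cast
  rw [Real.coe_toNNReal _ hε]
  exact norm_smul_add_smul_le (hA _ (fract_mem_Icc t)) (h₁.norm_le hε _) (h₂.norm_le hε _) hε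

/-- A lifted solution that visits a point off the support is constant. -/
theorem lift_solution_const (h₁ : IsBlockField ω ε r F₁) (h₂ : IsBlockField ω ε r F₂)
    {g : ℝ → Plane} (hg : ∀ t, HasDerivAt g (liftField F₁ F₂ t (g t)) t) {t₀ : ℝ}
    (h : r < ‖proj (g t₀)‖) (t : ℝ) : g t = g t₀ := by
  obtain ⟨K, hK⟩ := liftField_lipschitz h₁ h₂
  have hz : ∀ t, liftField F₁ F₂ t (g t₀) = 0 := fun t => by
    rw [liftField_apply, h₁.eq_zero _ h, h₂.eq_zero _ h, smul_zero, smul_zero, add_zero]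
  have := ODE_solution_unique_univ (v := liftField F₁ F₂) (s := fun _ => univ) (f := g)
    (g := fun _ => g t₀) (t₀ := t₀) (fun t => (hK t).lipschitzOnWith)
    (fun t => ⟨hg t, mem_univ _⟩)
    (fun t => ⟨by rw [hz t]; exact hasDerivAt_const _ _, mem_univ _⟩) rfl
  exact congrFun this t

theorem isTrajectory_of_hasDerivAt {u : ℝ → Torus → Plane} {g : ℝ → Plane}
    (hg : ∀ t, HasDerivAt g (u t (proj (g t))) t) (hc : Continuous fun t => u t (proj (g t))) :
    IsTrajectory u fun t => proj (g t) := by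
  refine ⟨g, fun t _ => ⟨rfl, hc.intervalIntegrable 0 t, ?_⟩⟩
  rw [intervalIntegral.integral_eq_sub_of_hasDerivAt (fun s _ => hg s) (hc.intervalIntegrable 0 t)]
  abel

/-- The properties of the flow of a block that the construction uses. -/
structure IsBlockFlow (r : ℝ) (F₁ F₂ : Torus → Plane) (Y : ℝ → Torus → Torus) : Prop where
  isFlowMap : IsFlowMap (periodize (blockField F₁ F₂)) Y
  continuous : Continuous (Y 1)
  exists_lift : ∀ p, ∃ g : ℝ → Plane, g 0 = p ∧ (∀ t, HasDerivAt g (liftField F₁ F₂ t (g t)) t) ∧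
    ∀ t, Y t (proj p) = proj (g t)
  eq_self : ∀ t x, r < ‖x‖ → Y t x = x
  norm_le : ∀ t x, ‖x‖ ≤ r → ‖Y t x‖ ≤ r
  surj : ∀ y, ‖y‖ ≤ r → ∃ x, ‖x‖ ≤ r ∧ Y 1 x = y

/-- Lifted solutions commute with translation by periods and so descend to the torus. Points off the
support are at rest, and uniqueness forbids crossing, so the ball is invariant. Solving backwards
from time `1` gives surjectivity, Grönwall gives continuity, and Osgood's lemma excludes other
integrated solutions. -/
theorem exists_isBlockFlow (hω : IsOsgoodModulus ω) (hε : 0 ≤ ε) (h₁ : IsBlockField ω ε r F₁)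
    (h₂ : IsBlockField ω ε r F₂) : ∃ Y, IsBlockFlow r F₁ F₂ Y := by
  obtain ⟨A, -, hA⟩ := exists_profile_bound
  obtain ⟨K, hK⟩ := liftField_lipschitz h₁ h₂
  choose φ hφ0 hφ using fun p => exists_lift_solution hε h₁ h₂ 0 p
  have huniq : ∀ {f g : ℝ → Plane}, (∀ t, HasDerivAt f (liftField F₁ F₂ t (f t)) t) →
      (∀ t, HasDerivAt g (liftField F₁ F₂ t (g t)) t) → f 0 = g 0 → f = g := fun hf hg h0 =>
    ODE_solution_unique_univ (s := fun _ => univ) (fun t => (hK t).lipschitzOnWith)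
      (fun t => ⟨hf t, mem_univ _⟩) (fun t => ⟨hg t, mem_univ _⟩) h0
  have hequiv : ∀ p q, proj p = proj q → ∀ t, proj (φ p t) = proj (φ q t) := by
    intro p q hpq t
    have hpr : ∀ s, proj (φ q s + (p - q)) = proj (φ q s) := fun s => proj_add_sub_of_eq hpq _
    have : φ p = fun s => φ q s + (p - q) := by
      refine huniq (hφ p) (fun s => ?_) (by simp [hφ0])
      have h := (hφ q s).add_const (p - q)
      have e : liftField F₁ F₂ s (φ q s + (p - q)) = liftField F₁ F₂ s (φ q s) := by
        rw [liftField, hpr, liftField]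
      rw [e]
      exact h
    rw [this]
    exact hpr t
  set Y : ℝ → Torus → Torus := fun t x => proj (φ (rep x) t) with hY
  have hYproj : ∀ t p, Y t (proj p) = proj (φ p t) := fun t p =>
    hequiv _ _ (proj_rep (proj p)) t
  have htraj : ∀ x, IsTrajectory (periodize (blockField F₁ F₂)) fun t => Y t x := fun x =>
    isTrajectory_of_hasDerivAt (hφ (rep x)) (liftField_continuous_comp h₁ h₂
      (continuous_iff_continuousAt.2 fun t => (hφ (rep x) t).continuousAt))
  have hmod : ∀ t, 0 ≤ t → ∀ x y, ‖periodize (blockField F₁ F₂) t x -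
      periodize (blockField F₁ F₂) t y‖ ≤ A * ε * ω (dist x y) := by
    intro t _ x y
    have e : periodize (blockField F₁ F₂) t x - periodize (blockField F₁ F₂) t y =
        deriv firstRamp (Int.fract t) • (F₁ x - F₁ y) +
        deriv secondRamp (Int.fract t) • (F₂ x - F₂ y) := by
      simp only [periodize, blockField_apply, smul_sub]; abel
    rw [e, mul_assoc]
    have h3 := norm_sub_le_of_omegaNorm_le hω hε h₁.omegaNorm_le x y
    exact norm_smul_add_smul_le (hA _ (fract_mem_Icc t)) h3
      (norm_sub_le_of_omegaNorm_le hω hε h₂.omegaNorm_le x y) ((norm_nonneg _).trans h3)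
  have hY0 : ∀ x, Y 0 x = x := fun x => by simp only [hY]; rw [hφ0, proj_rep]
  have hfix : ∀ t x, r < ‖x‖ → Y t x = x := by
    intro t x hx
    have h0 : r < ‖proj (φ (rep x) 0)‖ := by rwa [hφ0, proj_rep]
    simp only [hY]
    rw [lift_solution_const h₁ h₂ (hφ (rep x)) h0 t, hφ0, proj_rep]
  have hstay : ∀ t x, ‖x‖ ≤ r → ‖Y t x‖ ≤ r := by
    intro t x hx
    by_contra! hlt
    have h0 := lift_solution_const h₁ h₂ (hφ (rep x)) hlt 0
    rw [hφ0] at h0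
    have : ‖Y t x‖ = ‖x‖ := by simp only [hY]; rw [← h0, proj_rep]
    linarith
  refine ⟨Y, ⟨⟨fun x => ⟨hY0 x, htraj x⟩, fun Z hZ t ht => funext fun x => ?_⟩, ?_,
    fun p => ⟨φ p, hφ0 p, hφ p, fun t => hYproj t p⟩, hfix, hstay, fun y hy => ?_⟩⟩
  · exact (hZ x).2.eq_of_eq_zero hω (mul_nonneg A.2 hε) hmod (htraj x)
      ((hZ x).1.trans (hY0 x).symm) ht
  · refine (LipschitzWith.of_dist_le_mul (K := (Real.exp K).toNNReal) fun x y => ?_).continuous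
    obtain ⟨p, q, rfl, rfl, hpq⟩ := exists_lifts x y
    rw [hYproj, hYproj, Real.coe_toNNReal _ (Real.exp_pos _).le]
    refine (dist_proj_le _ _).trans ?_
    rw [← dist_eq_norm]
    have := dist_le_of_trajectories_ODE (a := 0) (b := 1) hK
      (fun t _ => (hφ p t).continuousAt.continuousWithinAt)
      (fun t _ => (hφ p t).hasDerivWithinAt)
      (fun t _ => (hφ q t).continuousAt.continuousWithinAt)
      (fun t _ => (hφ q t).hasDerivWithinAt) (le_of_eq (by rw [hφ0, hφ0, dist_eq_norm, hpq]))
      1 (right_mem_Icc.2 zero_le_one)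
    rw [sub_zero, mul_one, mul_comm] at this
    exact this
  · obtain ⟨g, hg1, hg⟩ := exists_lift_solution hε h₁ h₂ 1 (rep y)
    have hgφ : φ (g 0) = g := huniq (hφ _) hg (hφ0 _)
    have h1 : Y 1 (proj (g 0)) = y := by rw [hYproj, hgφ, hg1, proj_rep]
    refine ⟨proj (g 0), ?_, h1⟩
    by_contra! hlt
    have := hfix 1 _ hlt
    rw [h1] at this
    rw [← this] at hlt
    linarith

end BlockFlow

/-! ### The horseshoe of a block -/

/-- After a dilation by `ρ`, the fields `F₁` and `F₂` are a horizontal shear and, near the `m` lines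
`x = j`, a strongly expanding vertical shear. -/
structure IsShearPair (m : ℕ) (ρ r : ℝ) (F₁ F₂ : Torus → Plane) : Prop where
  pos : 0 < ρ
  mul_le : ρ * (7 * m) ≤ r
  first : ∀ p : Plane, ‖p‖ < 7 * m → F₁ (proj (ρ • p)) = ρ • !₂[p 1, 0]
  second : ∀ p : Plane, ‖p‖ < 7 * m → ∀ j : Fin m, |p 0 - ((j : ℕ) : ℝ)| < 1 / 4 →
    F₂ (proj (ρ • p)) = ρ • !₂[0, 64 * m * (p 0 - ((j : ℕ) : ℝ))]

theorem norm_vec_le (a b : ℝ) : ‖(!₂[a, b] : Plane)‖ ≤ |a| + |b| := by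
  rw [EuclideanSpace.norm_eq, Fin.sum_univ_two]
  refine Real.sqrt_le_iff.2 ⟨by positivity, ?_⟩
  simp only [Real.norm_eq_abs, Matrix.cons_val_zero, Matrix.cons_val_one]
  nlinarith [abs_nonneg a, abs_nonneg b]

theorem abs_interp_le {a b θ M : ℝ} (h0 : 0 ≤ θ) (h1 : θ ≤ 1) (ha : |a| ≤ M) (hab : |a + b| ≤ M) :
    |a + θ * b| ≤ M := by
  rw [abs_le] at *
  constructor <;> nlinarith

section Horseshoe

variable {ω : ℝ → ℝ} {ε r : ℝ} {F₁ F₂ : Torus → Plane} {m : ℕ} {ρ : ℝ}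

/-- On the region of the horseshoe the time-one map is the composition of the two shears. -/
theorem IsShearPair.flow_one (hs : IsShearPair m ρ r F₁ F₂) (hm : 0 < m)
    (h₁ : IsBlockField ω ε r F₁) (h₂ : IsBlockField ω ε r F₂) {Y : ℝ → Torus → Torus}
    (hY : IsBlockFlow r F₁ F₂ Y) {x y : ℝ} {j : Fin m} {c : ℝ}
    (hc : c = 64 * m * (x + y - ((j : ℕ) : ℝ)))
    (hj : |x + y - ((j : ℕ) : ℝ)| < 1 / 4) (hx : |x| ≤ 2 * m) (hxy : |x + y| ≤ 2 * m)
    (hy : |y| ≤ 4 * m) (hyc : |y + c| ≤ 4 * m) :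
    Y 1 (proj (ρ • !₂[x, y])) = proj (ρ • !₂[x + y, y + c]) := by
  have hm1 : (1 : ℝ) ≤ m := by exact_mod_cast hm
  obtain ⟨g, hg0, hg, hYg⟩ := hY.exists_lift (ρ • !₂[x, y])
  obtain ⟨K, hK⟩ := liftField_lipschitz h₁ h₂
  -- The explicit solution in dilated coordinates: only the first coordinate moves until time `1/2`,
  -- only the second afterwards.
  set P : ℝ → Plane := fun t => !₂[x + firstRamp t * y, y + secondRamp t * c] with hP
  -- The coordinates stay within `2 m` and `4 m`, so the norm is at most `6 m`, inside the region
  -- where the truncated fields are exact shears.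
  have hPn : ∀ t, ‖P t‖ < 7 * m := fun t => by
    refine (norm_vec_le _ _).trans_lt ?_
    have e1 := abs_interp_le (firstRamp_mem t).1 (firstRamp_mem t).2 hx hxy
    have e2 := abs_interp_le (secondRamp_mem t).1 (secondRamp_mem t).2 hy hyc
    linarith
  have hPd : ∀ t, HasDerivAt P !₂[deriv firstRamp t * y, deriv secondRamp t * c] t := fun t => by
    have d1 := ((firstRamp_smooth.differentiable (by simp) t).hasDerivAt.mul_const y).const_add x
    have d2 := ((secondRamp_smooth.differentiable (by simp) t).hasDerivAt.mul_const c).const_add y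
    have hpi : HasDerivAt (fun t => ![x + firstRamp t * y, y + secondRamp t * c])
        ![deriv firstRamp t * y, deriv secondRamp t * c] t := by
      refine hasDerivAt_pi.2 fun i => ?_
      fin_cases i
      · exact d1
      · exact d2
    exact (PiLp.hasFDerivAt_toLp (𝕜 := ℝ) 2 _).comp_hasDerivAt t hpi
  -- The endpoint `1` is left out since its fractional part is `0`; uniqueness up to time `1` needs
  -- the equation only on the half-open interval.
  have hfield : ∀ t ∈ Ico (0 : ℝ) 1, liftField F₁ F₂ t (ρ • P t) =
      ρ • !₂[deriv firstRamp t * y, deriv secondRamp t * c] := by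
    intro t ht
    rw [liftField_apply, Int.fract_eq_self.2 ht]
    rcases le_total t (1 / 2) with h | h
    · have hP1 : (P t) 1 = y := by simp [hP, secondRamp_of_le h]
      rw [deriv_secondRamp_of_le h, hs.first _ (hPn t), hP1]
      ext i; fin_cases i <;> simp; ring
    · have hP0 : (P t) 0 = x + y := by simp [hP, firstRamp_of_ge h]
      rw [deriv_firstRamp_of_ge h, hs.second _ (hPn t) j (by rwa [hP0]), hP0, ← hc]
      ext i; fin_cases i <;> simp; ring
  have heq := ODE_solution_unique (a := 0) (b := 1) (f := g) (g := fun t => ρ • P t) hK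
    (fun t _ => (hg t).continuousAt.continuousWithinAt) (fun t _ => (hg t).hasDerivWithinAt)
    (fun t _ => ((hPd t).const_smul ρ).continuousAt.continuousWithinAt)
    (fun t ht => by rw [hfield t ht]; exact ((hPd t).const_smul ρ).hasDerivWithinAt)
    (by rw [hg0]; simp [hP, firstRamp_of_le, secondRamp_of_le]) (right_mem_Icc.2 zero_le_one)
  rw [hYg, heq]
  simp only [hP]
  rw [firstRamp_of_ge (by norm_num), secondRamp_of_ge le_rfl, one_mul, one_mul]

/-- The time-one map of a block has a horseshoe with `m` symbols. -/
theorem IsShearPair.exists_horseshoe (hs : IsShearPair m ρ r F₁ F₂) (hm : 0 < m) (hr : r < 1 / 2)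
    (h₁ : IsBlockField ω ε r F₁) (h₂ : IsBlockField ω ε r F₂) {Y : ℝ → Torus → Torus}
    (hY : IsBlockFlow r F₁ F₂ Y) :
    ∃ H : Fin m → Set Torus, (∀ j, IsCompact (H j)) ∧
      (Pairwise fun i j => Disjoint (H i) (H j)) ∧ (∀ j, ∀ x ∈ H j, ‖x‖ ≤ r) ∧
      ∀ n : ℕ, 0 < n → ∀ w : Fin n → Fin m, ∃ x, ∀ i : Fin n, (Y 1)^[(i : ℕ)] x ∈ H (w i) := by
  have hm1 : (1 : ℝ) ≤ m := by exact_mod_cast hm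
  have hnorm : ∀ p : Plane, ‖p‖ ≤ 6 * m → ‖ρ • p‖ ≤ r := fun p hp => by
    rw [norm_smul, Real.norm_of_nonneg hs.pos.le]
    refine le_trans ?_ hs.mul_le
    gcongr
    · exact hs.pos.le
    · linarith
  refine ⟨fun j => (fun p : Plane => proj (ρ • p)) ''
    {p | ‖p‖ ≤ 6 * m ∧ |p 0 - ((j : ℕ) : ℝ)| ≤ 1 / 8}, fun j => ?_, fun i j hij => ?_, ?_, ?_⟩
  · refine IsCompact.image ?_ (continuous_proj.comp (continuous_const_smul ρ))
    have : {p : Plane | ‖p‖ ≤ 6 * m ∧ |p 0 - ((j : ℕ) : ℝ)| ≤ 1 / 8} =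
        Metric.closedBall 0 (6 * m) ∩ {p : Plane | |p 0 - ((j : ℕ) : ℝ)| ≤ 1 / 8} := by
      ext p; simp
    rw [this]
    refine (isCompact_closedBall _ _).inter_right (isClosed_le ?_ continuous_const)
    exact ((EuclideanSpace.proj (𝕜 := ℝ) (0 : Fin 2)).continuous.sub continuous_const).abs
  · refine disjoint_left.2 ?_
    rintro _ ⟨p, ⟨hp, hpi⟩, rfl⟩ ⟨q, ⟨hq, hqj⟩, hpq⟩
    have e := congrArg rep hpq
    simp only at e
    rw [rep_proj_of_norm_lt (by linarith [hnorm q hq]), rep_proj_of_norm_lt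
      (by linarith [hnorm p hp])] at e
    have e2 : q = p := smul_right_injective _ hs.pos.ne' e
    rw [e2] at hqj
    have h1 : (1 : ℝ) ≤ |((i : ℕ) : ℝ) - ((j : ℕ) : ℝ)| := by
      have : (1 : ℤ) ≤ |((i : ℕ) : ℤ) - ((j : ℕ) : ℤ)| :=
        Int.one_le_abs (sub_ne_zero.2 fun e => hij (Fin.ext (by exact_mod_cast e)))
      exact_mod_cast this
    have h2 := abs_sub (p 0 - ((j : ℕ) : ℝ)) (p 0 - ((i : ℕ) : ℝ))
    rw [show p 0 - ((j : ℕ) : ℝ) - (p 0 - ((i : ℕ) : ℝ)) = ((i : ℕ) : ℝ) - ((j : ℕ) : ℝ) by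
      ring] at h2
    linarith
  · rintro j _ ⟨p, ⟨hp, -⟩, rfl⟩
    exact (norm_proj_le _).trans (hnorm p hp)
  · intro n hn w
    have : NeZero n := ⟨hn.ne'⟩
    -- The finite word is repeated with period `n`; indexing by `ZMod n` makes the unknown a finite
    -- vector with no boundary conditions.
    obtain ⟨x, hx2, hxw, hrec⟩ := exists_periodic_solution hm
      fun k : ZMod n => w ⟨k.val, ZMod.val_lt k⟩
    have hdiff : ∀ k, |x (k + 1) - x k| ≤ 4 * m := fun k => by
      have := abs_sub (x (k + 1)) (x k)
      linarith [hx2 k, hx2 (k + 1)]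
    have hstep : ∀ k, Y 1 (proj (ρ • !₂[x k, x (k + 1) - x k])) =
        proj (ρ • !₂[x (k + 1), x (k + 1 + 1) - x (k + 1)]) := by
      intro k
      have hr := hrec (k + 1)
      rw [add_sub_cancel_right] at hr
      have hw := hxw (k + 1)
      have h := hs.flow_one hm h₁ h₂ hY (x := x k) (y := x (k + 1) - x k)
        (c := x (k + 1 + 1) - 2 * x (k + 1) + x k) (by rw [hr, add_sub_cancel])
        (by rw [add_sub_cancel]; linarith) (hx2 k) (by rw [add_sub_cancel]; exact hx2 _) (hdiff k)
        (by
          rw [show x (k + 1) - x k + (x (k + 1 + 1) - 2 * x (k + 1) + x k) =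
            x (k + 1 + 1) - x (k + 1) by ring]
          exact hdiff _)
      rw [h, add_sub_cancel, show x (k + 1) - x k + (x (k + 1 + 1) - 2 * x (k + 1) + x k) =
            x (k + 1 + 1) - x (k + 1) by ring]
    have hiter : ∀ i : ℕ, (Y 1)^[i] (proj (ρ • !₂[x 0, x (0 + 1) - x 0])) =
        proj (ρ • !₂[x (i : ZMod n), x ((i : ZMod n) + 1) - x (i : ZMod n)]) := by
      intro i
      induction i with
      | zero => simp
      | succ i ih => rw [Function.iterate_succ_apply', ih, hstep]; push_cast; rfl
    refine ⟨proj (ρ • !₂[x 0, x (0 + 1) - x 0]), fun i => ?_⟩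
    rw [hiter]
    refine ⟨_, ⟨(norm_vec_le _ _).trans ?_, ?_⟩, rfl⟩
    · linarith [hx2 (((i : ℕ) : ZMod n)), hdiff ((i : ℕ) : ZMod n)]
    · have := hxw ((i : ℕ) : ZMod n)
      simp only [ZMod.val_cast_of_lt i.2] at this
      exact this

end Horseshoe

/-- Blocks of arbitrarily small `ω`-norm and support with arbitrarily many symbols. -/
theorem exists_block {ω : ℝ → ℝ} (hω : IsOsgoodModulus ω) {m : ℕ} (hm : 0 < m) {ε r : ℝ} (hε : 0 < ε)
    (hr : 0 < r) (hr2 : r < 1 / 2) :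
    ∃ (F₁ F₂ : Torus → Plane) (ρ : ℝ), IsBlockField ω ε r F₁ ∧ IsBlockField ω ε r F₂ ∧
      IsShearPair m ρ r F₁ F₂ := by
  have hm' : (0 : ℝ) < m := by exact_mod_cast hm
  obtain ⟨W₁, W₂, ⟨hs₁, hs₂⟩, hd, hz, hW₁, hW₂⟩ :=
    exists_shear_fields m (64 * m) (7 * m) (by positivity)
  have hR : (0 : ℝ) < 7 * m + 1 := by positivity
  obtain ⟨ρ₁, hρ₁, hb₁⟩ := exists_isBlockField_rescale hω hR hs₁ (fun p => (hd p).1)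
    (fun p hp => (hz p hp).1) hε hr hr2
  obtain ⟨ρ₂, hρ₂, hb₂⟩ := exists_isBlockField_rescale hω hR hs₂ (fun p => (hd p).2)
    (fun p hp => (hz p hp).2) hε hr hr2
  set ρ := min (min ρ₁ ρ₂) (r / (7 * m)) with hρ_def
  have hρ : 0 < ρ := by positivity
  have hmul : ρ * (7 * m) ≤ r := (le_div_iff₀ (by positivity)).1 (min_le_right _ _)
  have hin : ∀ (W : Plane → Plane) (p : Plane), ‖p‖ < 7 * m →
      torusField (rescale ρ W) (proj (ρ • p)) = ρ • W p := fun W p hp => by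
    rw [torusField, rep_proj_of_norm_lt, rescale_smul hρ]
    rw [norm_smul, Real.norm_of_nonneg hρ.le]
    have : ρ * ‖p‖ ≤ ρ * (7 * m) := by gcongr
    linarith
  refine ⟨torusField (rescale ρ W₁), torusField (rescale ρ W₂), ρ,
    hb₁ ρ hρ ((min_le_left _ _).trans (min_le_left _ _)),
    hb₂ ρ hρ ((min_le_left _ _).trans (min_le_right _ _)), hρ, hmul, fun p hp => ?_,
    fun p hp j hj => ?_⟩
  · rw [hin _ p hp, hW₁ p hp]
  · rw [hin _ p hp, hW₂ p hp j hj]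

/-! ### Single blocks -/

section SingleBlock

variable {ω : ℝ → ℝ} {ε r : ℝ} {F₁ F₂ : Torus → Plane}

theorem omegaNorm_smul_add_smul_le (hω : ∀ s, 0 < s → 0 < ω s) (h₁ : IsBlockField ω ε r F₁)
    (h₂ : IsBlockField ω ε r F₂) (a b : ℝ) :
    omegaNorm ω (a • F₁ + b • F₂) ≤ ENNReal.ofReal (|a| + |b|) * ENNReal.ofReal ε := by
  refine (omegaNorm_add_le hω _ _).trans ?_
  rw [ENNReal.ofReal_add (abs_nonneg _) (abs_nonneg _), add_mul]
  exact add_le_add ((omegaNorm_smul_le _ _).trans (mul_le_mul_right h₁.omegaNorm_le _))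
    ((omegaNorm_smul_le _ _).trans (mul_le_mul_right h₂.omegaNorm_le _))

theorem omegaNorm_blockField_sub_le (hω : ∀ s, 0 < s → 0 < ω s) (h₁ : IsBlockField ω ε r F₁)
    (h₂ : IsBlockField ω ε r F₂) (s t : ℝ) :
    omegaNorm ω (blockField F₁ F₂ s - blockField F₁ F₂ t) ≤
      ENNReal.ofReal (|deriv firstRamp s - deriv firstRamp t| +
        |deriv secondRamp s - deriv secondRamp t|) * ENNReal.ofReal ε := by
  have e : blockField F₁ F₂ s - blockField F₁ F₂ t =
      (deriv firstRamp s - deriv firstRamp t) • F₁ +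
        (deriv secondRamp s - deriv secondRamp t) • F₂ := by
    simp only [blockField, sub_smul]; abel
  rw [e]
  exact omegaNorm_smul_add_smul_le hω h₁ h₂ _ _

theorem blockField_isSmooth (h₁ : IsBlockField ω ε r F₁) (h₂ : IsBlockField ω ε r F₂) (t : ℝ) :
    IsSmooth (blockField F₁ F₂ t) :=
  (ContDiff.const_smul (deriv firstRamp t) h₁.smooth).add
    (ContDiff.const_smul (deriv secondRamp t) h₂.smooth)

theorem blockField_isSmoothField (h₁ : IsBlockField ω ε r F₁) (h₂ : IsBlockField ω ε r F₂) :
    IsSmoothField (blockField F₁ F₂) := by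
  have g : ∀ {F : Torus → Plane} {θ : ℝ → ℝ}, IsSmooth F →
      ContDiff ℝ ((⊤ : ℕ∞) : WithTop ℕ∞) θ →
      ContDiff ℝ ((⊤ : ℕ∞) : WithTop ℕ∞) fun p : ℝ × Plane => θ p.1 • F (proj p.2) :=
    fun {F} _ hF hθ => (hθ.comp contDiff_fst).smul
      (ContDiff.comp (g := fun v : Plane => F (proj v)) hF contDiff_snd)
  exact ((g h₁.smooth (deriv_smooth firstRamp_smooth)).add
    (g h₂.smooth (deriv_smooth secondRamp_smooth))).contDiffOn

theorem blockField_isIncompressible (h₁ : IsBlockField ω ε r F₁) (h₂ : IsBlockField ω ε r F₂) :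
    IsIncompressible (blockField F₁ F₂) := by
  intro t _ v
  have d₁ : DifferentiableAt ℝ (fun p => F₁ (proj p)) v :=
    ContDiff.differentiable h₁.smooth (by simp) v
  have d₂ : DifferentiableAt ℝ (fun p => F₂ (proj p)) v :=
    ContDiff.differentiable h₂.smooth (by simp) v
  have e : fderiv ℝ (fun w => blockField F₁ F₂ t (proj w)) v =
      deriv firstRamp t • fderiv ℝ (fun p => F₁ (proj p)) v +
        deriv secondRamp t • fderiv ℝ (fun p => F₂ (proj p)) v :=
    ((d₁.hasFDerivAt.const_smul _).add (d₂.hasFDerivAt.const_smul _)).fderiv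
  have z₁ := h₁.divergence_eq_zero v
  have z₂ := h₂.divergence_eq_zero v
  unfold divergence at z₁ z₂
  rw [Fin.sum_univ_two] at z₁ z₂ ⊢
  rw [e]
  simp only [add_apply, smul_apply, PiLp.add_apply, PiLp.smul_apply, smul_eq_mul]
  linear_combination deriv firstRamp t * z₁ + deriv secondRamp t * z₂

theorem blockField_memCZero (hω : ∀ s, 0 < s → 0 < ω s) (h₁ : IsBlockField ω ε r F₁)
    (h₂ : IsBlockField ω ε r F₂) : MemCZero ω (blockField F₁ F₂) := by
  refine ⟨fun t _ => (blockField_isSmooth h₁ h₂ t).mem_cOmega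
    ((omegaNorm_smul_add_smul_le hω h₁ h₂ _ _).trans_lt
      (ENNReal.mul_lt_top ENNReal.ofReal_lt_top ENNReal.ofReal_lt_top)), fun t _ => ?_⟩
  refine tendsto_of_tendsto_of_tendsto_of_le_of_le tendsto_const_nhds ?_ (fun _ => zero_le)
    fun s => omegaNorm_blockField_sub_le hω h₁ h₂ s t
  have hc : Continuous fun s : ℝ => |deriv firstRamp s - deriv firstRamp t| +
      |deriv secondRamp s - deriv secondRamp t| :=
    ((deriv_smooth firstRamp_smooth).continuous.sub continuous_const).abs.add
      ((deriv_smooth secondRamp_smooth).continuous.sub continuous_const).abs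
  have h := (ENNReal.tendsto_ofReal (hc.tendsto t)).mono_left (nhdsWithin_le_nhds (s := Icc 0 1))
  have := ENNReal.Tendsto.mul_const (b := ENNReal.ofReal ε) h (Or.inr ENNReal.ofReal_ne_top)
  simpa using this

theorem blockField_eq_zero (h₁ : IsBlockField ω ε r F₁) (h₂ : IsBlockField ω ε r F₂) (t : ℝ)
    {x : Torus} (hx : r < ‖x‖) : blockField F₁ F₂ t x = 0 := by
  rw [blockField_apply, h₁.eq_zero x hx, h₂.eq_zero x hx, smul_zero, smul_zero, add_zero]

theorem blockField_support (h₁ : IsBlockField ω ε r F₁) (h₂ : IsBlockField ω ε r F₂) :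
    spaceTimeSupport (blockField F₁ F₂) ⊆ Icc 0 1 ×ˢ Metric.closedBall 0 r := by
  refine closure_minimal (fun p hp => ⟨hp.1, ?_⟩) (isClosed_Icc.prod Metric.isClosed_closedBall)
  rw [mem_closedBall_zero_iff]
  by_contra! h
  exact hp.2 (blockField_eq_zero h₁ h₂ _ h)

end SingleBlock

/-! ### Geometry of the blocks -/

theorem blockRadius_eq (N : ℕ+) : blockRadius N = (1 / 2) ^ (N : ℕ) / 4 := by
  rw [blockRadius, zpow_sub₀ two_ne_zero, zpow_neg, zpow_natCast, one_div, inv_pow]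
  norm_num

theorem blockRadius_pos (N : ℕ+) : 0 < blockRadius N := by
  rw [blockRadius_eq]; positivity

theorem half_pow_le (N : ℕ+) : (1 / 2 : ℝ) ^ (N : ℕ) ≤ 1 / 2 := by
  have := pow_le_pow_of_le_one (show (0 : ℝ) ≤ 1 / 2 by norm_num) (by norm_num) N.pos
  simpa using this

theorem summable_blockRadius : Summable blockRadius := by
  have h : Summable fun n : ℕ => (1 / 2 : ℝ) ^ n / 4 :=
    (summable_geometric_of_lt_one (by norm_num) (by norm_num)).div_const 4
  exact (h.comp_injective PNat.coe_injective).congr fun N => (blockRadius_eq N).symm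

/-- The second coordinates suffice. For `M < N` they differ by at least `2 ^ (-M)`, while the radii
add up to at most `3/8` of that; the difference is at most `1`, so it is not shortened on the circle
of length `2`. -/
theorem disjoint_closedBall_blocks : Pairwise fun M N : ℕ+ =>
    Disjoint (Metric.closedBall (blockCenter M) (blockRadius M))
      (Metric.closedBall (blockCenter N) (blockRadius N)) := by
  refine (pairwise_disjoint_on _).2 fun M N hMN => Metric.closedBall_disjoint_closedBall ?_
  have hz : ∀ N : ℕ+, (2 : ℝ) ^ (-((N : ℕ) : ℤ) + 1) = 2 * (1 / 2) ^ (N : ℕ) := fun N => by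
    rw [zpow_add₀ two_ne_zero, zpow_neg, zpow_natCast, one_div, inv_pow, zpow_one, mul_comm]
  have hle : (1 / 2 : ℝ) ^ (N : ℕ) ≤ (1 / 2) ^ (M : ℕ) / 2 := by
    have := pow_le_pow_of_le_one (show (0 : ℝ) ≤ 1 / 2 by norm_num) (by norm_num)
      (Nat.succ_le_of_lt (show (M : ℕ) < N from hMN))
    rw [pow_succ] at this
    linarith
  have hM := half_pow_le M
  have hN : (0 : ℝ) < (1 / 2) ^ (N : ℕ) := by positivity
  have hd : 2 * (1 / 2 : ℝ) ^ (M : ℕ) - 2 * (1 / 2) ^ (N : ℕ) ≤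
      dist (blockCenter M) (blockCenter N) := by
    rw [dist_eq_norm, blockCenter, blockCenter, ← proj_sub]
    refine le_trans (le_of_eq ?_) (PiLp.norm_apply_le _ (1 : Fin 2))
    have e : (!₂[-1 / 2, -1 + (2 : ℝ) ^ (-((M : ℕ) : ℤ) + 1)] -
        !₂[-1 / 2, -1 + (2 : ℝ) ^ (-((N : ℕ) : ℤ) + 1)] : Plane) 1 =
        2 * (1 / 2 : ℝ) ^ (M : ℕ) - 2 * (1 / 2) ^ (N : ℕ) := by
      rw [hz, hz]; simp
    have hpos : 0 ≤ 2 * (1 / 2 : ℝ) ^ (M : ℕ) - 2 * (1 / 2) ^ (N : ℕ) := by linarith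
    rw [proj_apply, e, (AddCircle.norm_coe_eq_abs_iff (p := (2 : ℝ)) two_ne_zero).2,
      abs_of_nonneg hpos]
    rw [abs_of_nonneg hpos, abs_two]
    linarith
  rw [blockRadius_eq, blockRadius_eq]
  linarith

section BlockSum

variable {V : Type*} [AddCommMonoid V] [TopologicalSpace V] {f : ℕ+ → Torus → V}

/-- At most one term is nonzero at each point. The target `V` is general so that this covers
velocities, with values in the plane, and displacements, with values in the torus. -/
theorem hasSum_blocks_of_mem (hf : ∀ N y, blockRadius N ≤ ‖y‖ → f N y = 0) {N : ℕ+} {x : Torus}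
    (hx : x ∈ Metric.closedBall (blockCenter N) (blockRadius N)) :
    HasSum (fun M => f M (x - blockCenter M)) (f N (x - blockCenter N)) := by
  refine hasSum_single N fun M hMN => hf M _ ?_
  have := disjoint_left.1 (disjoint_closedBall_blocks hMN.symm) hx
  rw [mem_closedBall_iff_norm, not_le] at this
  exact this.le

theorem hasSum_blocks_of_notMem (hf : ∀ N y, blockRadius N ≤ ‖y‖ → f N y = 0) {x : Torus}
    (hx : ∀ N, x ∉ Metric.closedBall (blockCenter N) (blockRadius N)) :
    HasSum (fun M => f M (x - blockCenter M)) 0 := by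
  have : (fun M => f M (x - blockCenter M)) = fun _ => 0 := funext fun M => hf M _ <| by
    have := hx M
    rw [mem_closedBall_iff_norm, not_le] at this
    exact this.le
  rw [this]
  exact hasSum_zero

theorem summable_blocks (hf : ∀ N y, blockRadius N ≤ ‖y‖ → f N y = 0) (x : Torus) :
    Summable fun M => f M (x - blockCenter M) := by
  by_cases h : ∃ N, x ∈ Metric.closedBall (blockCenter N) (blockRadius N)
  · obtain ⟨N, hN⟩ := h
    exact (hasSum_blocks_of_mem hf hN).summable
  · push Not at h
    exact (hasSum_blocks_of_notMem hf h).summable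

end BlockSum

theorem ofReal_inv_sq (N : ℕ+) :
    ENNReal.ofReal ((((N : ℕ) : ℝ) ^ 2)⁻¹) = (((N : ℕ) : ℝ≥0∞) ^ 2)⁻¹ := by
  rw [ENNReal.ofReal_inv_of_pos (by have := N.pos; positivity), ENNReal.ofReal_pow (by positivity),
    ENNReal.ofReal_natCast]

theorem tsum_inv_sq_ne_top : ∑' N : ℕ+, (((N : ℕ) : ℝ≥0∞) ^ 2)⁻¹ ≠ ∞ := by
  have h : Summable fun N : ℕ+ => (((N : ℕ) : ℝ) ^ 2)⁻¹ :=
    (Real.summable_nat_pow_inv.2 one_lt_two).comp_injective PNat.coe_injective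
  simpa only [ofReal_inv_sq] using h.tsum_ofReal_ne_top

/-! ### The sum of the blocks -/

/-- A sequence of blocks of summable size, together with their flows and horseshoes. -/
structure IsBlockFamily (ω : ℝ → ℝ) (ε : ℕ+ → ℝ) (F₁ F₂ : ℕ+ → Torus → Plane)
    (Y : ℕ+ → ℝ → Torus → Torus) (ρ : ℕ+ → ℝ) : Prop where
  bound : ∀ t ∈ Icc (0 : ℝ) 1, ∀ N,
    ENNReal.ofReal (|deriv firstRamp t| + |deriv secondRamp t|) * ENNReal.ofReal (ε N) ≤
      (((N : ℕ) : ℝ≥0∞) ^ 2)⁻¹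
  summable : ∑' N, ENNReal.ofReal (ε N) ≠ ∞
  field₁ : ∀ N, IsBlockField ω (ε N) (blockRadius N / 2) (F₁ N)
  field₂ : ∀ N, IsBlockField ω (ε N) (blockRadius N / 2) (F₂ N)
  flow : ∀ N, IsBlockFlow (blockRadius N / 2) (F₁ N) (F₂ N) (Y N)
  shear : ∀ N : ℕ+, IsShearPair (3 ^ (N : ℕ)) (ρ N) (blockRadius N / 2) (F₁ N) (F₂ N)

theorem exists_isBlockFamily {ω : ℝ → ℝ} (hω : IsOsgoodModulus ω) :
    ∃ ε F₁ F₂ Y ρ, IsBlockFamily ω ε F₁ F₂ Y ρ := by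
  obtain ⟨A, hA0, hA⟩ := exists_profile_bound
  -- Division by the bound `A` on the time profiles makes the time-dependent block, and not only its
  -- two factors, have norm at most `N⁻²`.
  set ε : ℕ+ → ℝ := fun N => (((N : ℕ) : ℝ) ^ 2)⁻¹ / A with hε
  have hN : ∀ N : ℕ+, (0 : ℝ) < (N : ℕ) := fun N => by exact_mod_cast N.pos
  have hε0 : ∀ N, 0 < ε N := fun N => by
    have := hN N
    positivity
  have hr : ∀ N, blockRadius N / 2 < 1 / 2 := fun N => by
    rw [blockRadius_eq]
    linarith [half_pow_le N]
  have hr0 : ∀ N, 0 < blockRadius N / 2 := fun N => half_pos (blockRadius_pos N)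
  choose F₁ F₂ ρ h₁ h₂ hs using fun N : ℕ+ =>
    exists_block hω (m := 3 ^ (N : ℕ)) (by positivity) (hε0 N) (hr0 N) (hr N)
  choose Y hY using fun N => exists_isBlockFlow hω (hε0 N).le (h₁ N) (h₂ N)
  refine ⟨ε, F₁, F₂, Y, ρ, fun t ht N => ?_, ?_, h₁, h₂, hY, hs⟩
  · rw [← ENNReal.ofReal_mul (by positivity), ← ofReal_inv_sq]
    refine ENNReal.ofReal_le_ofReal ?_
    calc (|deriv firstRamp t| + |deriv secondRamp t|) * ε N ≤ A * ε N :=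
          mul_le_mul_of_nonneg_right (hA t ht) (hε0 N).le
      _ = (((N : ℕ) : ℝ) ^ 2)⁻¹ := mul_div_cancel₀ _ (by positivity)
  · have h : Summable fun N : ℕ+ => (((N : ℕ) : ℝ) ^ 2)⁻¹ :=
      (Real.summable_nat_pow_inv.2 one_lt_two).comp_injective PNat.coe_injective
    exact (h.div_const (A : ℝ)).tsum_ofReal_ne_top

/-- The sum of the translated blocks. -/
noncomputable def sumField (F₁ F₂ : ℕ+ → Torus → Plane) (t : ℝ) (x : Torus) : Plane :=
  ∑' N, periodize (blockField (F₁ N) (F₂ N)) t (x - blockCenter N)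

/-- The flow of the sum of the translated blocks. -/
noncomputable def sumFlow (Y : ℕ+ → ℝ → Torus → Torus) (t : ℝ) (x : Torus) : Torus :=
  x + ∑' N, (Y N t (x - blockCenter N) - (x - blockCenter N))

namespace IsBlockFamily

variable {ω : ℝ → ℝ} {ε : ℕ+ → ℝ} {F₁ F₂ : ℕ+ → Torus → Plane} {Y : ℕ+ → ℝ → Torus → Torus}
  {ρ : ℕ+ → ℝ}

/-- The blocks are built with half the allotted radius, so that their closed supports lie in the
open balls and they already vanish on the bounding spheres. -/
theorem half_lt {N : ℕ+} {a : ℝ} (h : blockRadius N ≤ a) : blockRadius N / 2 < a := by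
  linarith [blockRadius_pos N]

theorem periodize_eq_zero (h : IsBlockFamily ω ε F₁ F₂ Y ρ) (t : ℝ) (N : ℕ+) (y : Torus)
    (hy : blockRadius N ≤ ‖y‖) : periodize (blockField (F₁ N) (F₂ N)) t y = 0 :=
  blockField_eq_zero (h.field₁ N) (h.field₂ N) _ (half_lt hy)

theorem displacement_eq_zero (h : IsBlockFamily ω ε F₁ F₂ Y ρ) (t : ℝ) (N : ℕ+) (y : Torus)
    (hy : blockRadius N ≤ ‖y‖) : Y N t y - y = 0 := by
  rw [(h.flow N).eq_self t y (half_lt hy), sub_self]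

theorem hasSum_sumField (h : IsBlockFamily ω ε F₁ F₂ Y ρ) (t : ℝ) (x : Torus) :
    HasSum (fun N => periodize (blockField (F₁ N) (F₂ N)) t (x - blockCenter N))
      (sumField F₁ F₂ t x) :=
  (summable_blocks (h.periodize_eq_zero t) x).hasSum

theorem sumField_of_mem (h : IsBlockFamily ω ε F₁ F₂ Y ρ) (t : ℝ) {N : ℕ+} {x : Torus}
    (hx : x ∈ Metric.closedBall (blockCenter N) (blockRadius N)) :
    sumField F₁ F₂ t x = periodize (blockField (F₁ N) (F₂ N)) t (x - blockCenter N) :=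
  (hasSum_blocks_of_mem (h.periodize_eq_zero t) hx).tsum_eq

theorem sumField_of_notMem (h : IsBlockFamily ω ε F₁ F₂ Y ρ) (t : ℝ) {x : Torus}
    (hx : ∀ N, x ∉ Metric.closedBall (blockCenter N) (blockRadius N)) :
    sumField F₁ F₂ t x = 0 :=
  (hasSum_blocks_of_notMem (h.periodize_eq_zero t) hx).tsum_eq

theorem sumFlow_of_mem (h : IsBlockFamily ω ε F₁ F₂ Y ρ) (t : ℝ) {N : ℕ+} {x : Torus}
    (hx : x ∈ Metric.closedBall (blockCenter N) (blockRadius N)) :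
    sumFlow Y t x = blockCenter N + Y N t (x - blockCenter N) := by
  rw [sumFlow, (hasSum_blocks_of_mem (h.displacement_eq_zero t) hx).tsum_eq]
  abel

theorem sumFlow_of_notMem (h : IsBlockFamily ω ε F₁ F₂ Y ρ) (t : ℝ) {x : Torus}
    (hx : ∀ N, x ∉ Metric.closedBall (blockCenter N) (blockRadius N)) :
    sumFlow Y t x = x := by
  rw [sumFlow, (hasSum_blocks_of_notMem (h.displacement_eq_zero t) hx).tsum_eq, add_zero]

theorem flow_norm_le (h : IsBlockFamily ω ε F₁ F₂ Y ρ) (t : ℝ) (N : ℕ+) {y : Torus}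
    (hy : ‖y‖ ≤ blockRadius N) : ‖Y N t y‖ ≤ blockRadius N := by
  rcases le_or_gt ‖y‖ (blockRadius N / 2) with h1 | h1
  · linarith [(h.flow N).norm_le t y h1, blockRadius_pos N]
  · rwa [(h.flow N).eq_self t y h1]

/-! #### Regularity of the sum -/

theorem omegaNorm_block_le (hω : IsOsgoodModulus ω) (h : IsBlockFamily ω ε F₁ F₂ Y ρ) {t : ℝ}
    (ht : t ∈ Icc (0 : ℝ) 1) (N : ℕ+) :
    omegaNorm ω (blockField (F₁ N) (F₂ N) t) ≤ (((N : ℕ) : ℝ≥0∞) ^ 2)⁻¹ :=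
  (omegaNorm_smul_add_smul_le hω.pos (h.field₁ N) (h.field₂ N) _ _).trans (h.bound t ht N)

theorem tsum_omegaNorm_le (hω : IsOsgoodModulus ω) (h : IsBlockFamily ω ε F₁ F₂ Y ρ) (t : ℝ) :
    ∑' N, omegaNorm ω (fun x => periodize (blockField (F₁ N) (F₂ N)) t (x - blockCenter N)) ≤
      ∑' N : ℕ+, (((N : ℕ) : ℝ≥0∞) ^ 2)⁻¹ :=
  ENNReal.tsum_le_tsum fun N => (omegaNorm_comp_sub_le _ _).trans
    (h.omegaNorm_block_le hω (fract_mem_Icc t) N)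

theorem omegaNorm_sumField_le (hω : IsOsgoodModulus ω) (h : IsBlockFamily ω ε F₁ F₂ Y ρ) (t : ℝ) :
    omegaNorm ω (sumField F₁ F₂ t) ≤ ∑' N : ℕ+, (((N : ℕ) : ℝ≥0∞) ^ 2)⁻¹ :=
  (omegaNorm_le_tsum hω.pos (h.hasSum_sumField t)).trans (h.tsum_omegaNorm_le hω t)

theorem sumField_mem (hω : IsOsgoodModulus ω) (h : IsBlockFamily ω ε F₁ F₂ Y ρ) (t : ℝ) :
    sumField F₁ F₂ t ∈ cOmega ω :=
  mem_cOmega_of_hasSum hω.pos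
    (fun N => (blockField_isSmooth (h.field₁ N) (h.field₂ N) (Int.fract t)).comp_sub _)
    (h.hasSum_sumField t)
    ((h.tsum_omegaNorm_le hω t).trans_lt tsum_inv_sq_ne_top.lt_top).ne

/-- All blocks share the same two time profiles, so the sum is continuous in time for the `ω`-norm,
with a modulus given by these profiles alone. -/
theorem omegaNorm_sumField_sub_le (hω : IsOsgoodModulus ω) (h : IsBlockFamily ω ε F₁ F₂ Y ρ)
    (s t : ℝ) :
    omegaNorm ω (sumField F₁ F₂ s - sumField F₁ F₂ t) ≤
      ENNReal.ofReal (|deriv firstRamp (Int.fract s) - deriv firstRamp (Int.fract t)| +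
        |deriv secondRamp (Int.fract s) - deriv secondRamp (Int.fract t)|) *
          ∑' N, ENNReal.ofReal (ε N) := by
  rw [← ENNReal.tsum_mul_left]
  refine (omegaNorm_le_tsum hω.pos fun x =>
    (h.hasSum_sumField s x).sub (h.hasSum_sumField t x)).trans (ENNReal.tsum_le_tsum fun N => ?_)
  exact (omegaNorm_comp_sub_le (blockField (F₁ N) (F₂ N) (Int.fract s) -
    blockField (F₁ N) (F₂ N) (Int.fract t)) (blockCenter N)).trans
    (omegaNorm_blockField_sub_le hω.pos (h.field₁ N) (h.field₂ N) _ _)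

theorem sumField_periodic (t : ℝ) : sumField F₁ F₂ (t + 1) = sumField F₁ F₂ t := by
  funext x
  simp only [sumField, periodize, Int.fract_add_one]

theorem tendsto_floor_div_fract (t : ℝ) :
    Tendsto (fun n : ℕ => (⌊((n : ℝ) + 1) * Int.fract t⌋₊ : ℝ) / ((n : ℝ) + 1)) atTop
      (𝓝 (Int.fract t)) := by
  have h := (tendsto_nat_floor_mul_div_atTop (Int.fract_nonneg t)).comp
    (tendsto_atTop_add_const_right _ (1 : ℝ) tendsto_natCast_atTop_atTop)
  refine h.congr fun n => ?_
  simp only [Function.comp_apply]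
  rw [mul_comm]

/-- The approximation of the sum that is constant on intervals of length `1 / (n + 1)`. -/
noncomputable def stepField (F₁ F₂ : ℕ+ → Torus → Plane) (n : ℕ) : SimpleFunc ℝ (Torus → Plane) where
  toFun t := sumField F₁ F₂ ((⌊((n : ℝ) + 1) * Int.fract t⌋₊ : ℝ) / ((n : ℝ) + 1))
  measurableSet_fiber' y := by
    have hm : Measurable fun t : ℝ => ⌊((n : ℝ) + 1) * Int.fract t⌋₊ :=
      Nat.measurable_floor.comp (measurable_fract.const_mul _)
    exact hm (MeasurableSet.of_discrete
      (s := {k : ℕ | sumField F₁ F₂ ((k : ℝ) / ((n : ℝ) + 1)) = y}))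
  finite_range' := by
    refine ((finite_Iio (n + 1)).image
      fun k : ℕ => sumField F₁ F₂ ((k : ℝ) / ((n : ℝ) + 1))).subset ?_
    rintro _ ⟨t, rfl⟩
    refine ⟨_, ?_, rfl⟩
    have h0 : (0 : ℝ) < (n : ℝ) + 1 := by positivity
    rw [mem_Iio, Nat.floor_lt (mul_nonneg h0.le (Int.fract_nonneg t))]
    push_cast
    exact mul_lt_of_lt_one_right h0 (Int.fract_lt_one t)

/-- Continuity in time lets samples on a grid of mesh `1 / (n + 1)` converge at every time;
periodicity leaves only finitely many sampled values. -/
theorem sumField_isStronglyMeasurable (hω : IsOsgoodModulus ω) (h : IsBlockFamily ω ε F₁ F₂ Y ρ) :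
    IsStronglyMeasurable ω (sumField F₁ F₂) := by
  refine ⟨stepField F₁ F₂, fun n t => h.sumField_mem hω _, Eventually.of_forall fun t => ?_⟩
  refine tendsto_of_tendsto_of_tendsto_of_le_of_le tendsto_const_nhds ?_ (fun _ => zero_le)
    fun n => h.omegaNorm_sumField_sub_le hω t _
  have hc : Continuous fun s : ℝ =>
      |deriv firstRamp (Int.fract t) - deriv firstRamp (Int.fract s)| +
        |deriv secondRamp (Int.fract t) - deriv secondRamp (Int.fract s)| :=
    (continuous_const.sub continuous_deriv_firstRamp_fract).abs.add
      (continuous_const.sub continuous_deriv_secondRamp_fract).abs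
  have h1 := ENNReal.tendsto_ofReal ((hc.tendsto (Int.fract t)).comp (tendsto_floor_div_fract t))
  have h2 := ENNReal.Tendsto.mul_const (b := ∑' N, ENNReal.ofReal (ε N)) h1 (Or.inr h.summable)
  simpa [Int.fract_fract] using h2

theorem sumField_memLOnePer (hω : IsOsgoodModulus ω) (h : IsBlockFamily ω ε F₁ F₂ Y ρ) :
    MemLOnePer ω (sumField F₁ F₂) where
  mem t _ := h.sumField_mem hω t
  periodic t _ := sumField_periodic t
  measurable := h.sumField_isStronglyMeasurable hω
  integrable := by
    refine (lintegral_mono fun t => h.omegaNorm_sumField_le hω t).trans_lt ?_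
    simpa using tsum_inv_sq_ne_top.lt_top

/-! #### The flow of the sum -/

/-- A point of a ball never leaves it, so along its orbit the sum reduces to one translated block.
Points outside all the balls are at rest. -/
theorem sumFlow_isTrajectory (h : IsBlockFamily ω ε F₁ F₂ Y ρ) (x : Torus) :
    IsTrajectory (sumField F₁ F₂) fun t => sumFlow Y t x := by
  by_cases hx : ∃ N, x ∈ Metric.closedBall (blockCenter N) (blockRadius N)
  · obtain ⟨N, hN⟩ := hx
    obtain ⟨g, hg0, hg, hYg⟩ := (h.flow N).exists_lift (rep (x - blockCenter N))
    rw [proj_rep] at hYg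
    have hp : ∀ t, proj (rep (blockCenter N) + g t) = sumFlow Y t x := fun t => by
      rw [proj_add, proj_rep, ← hYg, h.sumFlow_of_mem t hN]
    have hf : ∀ t, sumField F₁ F₂ t (proj (rep (blockCenter N) + g t)) =
        liftField (F₁ N) (F₂ N) t (g t) := fun t => by
      have e : proj (rep (blockCenter N) + g t) - blockCenter N = proj (g t) := by
        rw [proj_add, proj_rep, add_sub_cancel_left]
      rw [h.sumField_of_mem t (N := N), e, liftField]
      rw [mem_closedBall_iff_norm, e, ← hYg]
      exact h.flow_norm_le t N (mem_closedBall_iff_norm.1 hN)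
    have := isTrajectory_of_hasDerivAt (u := sumField F₁ F₂)
      (g := fun t => rep (blockCenter N) + g t)
      (fun t => by rw [hf t]; exact (hg t).const_add _)
      (by
        simp only [hf]
        exact liftField_continuous_comp (h.field₁ N) (h.field₂ N)
          (continuous_iff_continuousAt.2 fun t => (hg t).continuousAt))
    simpa only [hp] using this
  · push Not at hx
    have hf : ∀ t, sumField F₁ F₂ t (proj (rep x)) = 0 := fun t => by
      rw [proj_rep, h.sumField_of_notMem t hx]
    have := isTrajectory_of_hasDerivAt (u := sumField F₁ F₂) (g := fun _ => rep x)
      (fun t => by rw [hf t]; exact hasDerivAt_const _ _) (by simp only [hf]; exact continuous_const)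
    simpa only [proj_rep, h.sumFlow_of_notMem _ hx] using this

theorem sumFlow_zero (h : IsBlockFamily ω ε F₁ F₂ Y ρ) (x : Torus) : sumFlow Y 0 x = x := by
  have : ∀ N y, Y N 0 y = y := fun N y => ((h.flow N).isFlowMap.1 y).1
  simp [sumFlow, this]

/-- The Lipschitz constants of the blocks are not bounded uniformly; uniqueness rests on the common
modulus `C ω`, where `C` is the sum of the series of norms. -/
theorem sumFlow_isFlowMap (hω : IsOsgoodModulus ω) (h : IsBlockFamily ω ε F₁ F₂ Y ρ) :
    IsFlowMap (sumField F₁ F₂) (sumFlow Y) := by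
  refine ⟨fun x => ⟨h.sumFlow_zero x, h.sumFlow_isTrajectory x⟩, fun Z hZ t ht => funext fun x => ?_⟩
  refine (hZ x).2.eq_of_eq_zero hω (C := (∑' N : ℕ+, (((N : ℕ) : ℝ≥0∞) ^ 2)⁻¹).toReal)
    ENNReal.toReal_nonneg (fun s _ => ?_)
    (h.sumFlow_isTrajectory x) ((hZ x).1.trans (h.sumFlow_zero x).symm) ht
  refine norm_sub_le_of_omegaNorm_le hω ENNReal.toReal_nonneg ?_
  rw [ENNReal.ofReal_toReal tsum_inv_sq_ne_top]
  exact h.omegaNorm_sumField_le hω s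

/-- Each displacement is at most twice the radius of its ball, and the radii are summable, so the
series converges uniformly. -/
theorem sumFlow_continuous (h : IsBlockFamily ω ε F₁ F₂ Y ρ) : Continuous (sumFlow Y 1) := by
  refine continuous_id.add (continuous_tsum (u := fun N => 2 * blockRadius N) (fun N => ?_)
    (summable_blockRadius.mul_left 2) fun N x => ?_)
  · exact ((h.flow N).continuous.comp (continuous_id.sub continuous_const)).sub
      (continuous_id.sub continuous_const)
  · rcases le_or_gt ‖x - blockCenter N‖ (blockRadius N) with h1 | h1
    · refine (norm_sub_le _ _).trans ?_
      linarith [h.flow_norm_le 1 N h1]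
    · rw [h.displacement_eq_zero 1 N _ h1.le, norm_zero]
      linarith [blockRadius_pos N]

/-- Surjectivity is checked in two zones: the inner ball of half radius is covered by its own image,
and the remaining shell is fixed pointwise. -/
theorem sumFlow_image (h : IsBlockFamily ω ε F₁ F₂ Y ρ) (N : ℕ+) :
    sumFlow Y 1 '' Metric.closedBall (blockCenter N) (blockRadius N) =
      Metric.closedBall (blockCenter N) (blockRadius N) := by
  refine Subset.antisymm ?_ fun z hz => ?_
  · rintro _ ⟨x, hx, rfl⟩
    rw [h.sumFlow_of_mem 1 hx, mem_closedBall_iff_norm, add_sub_cancel_left]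
    exact h.flow_norm_le 1 N (mem_closedBall_iff_norm.1 hx)
  · have hy := mem_closedBall_iff_norm.1 hz
    obtain ⟨y, hyN, hYy⟩ : ∃ y, ‖y‖ ≤ blockRadius N ∧ Y N 1 y = z - blockCenter N := by
      rcases le_or_gt ‖z - blockCenter N‖ (blockRadius N / 2) with h1 | h1
      · obtain ⟨y, hy1, hy2⟩ := (h.flow N).surj _ h1
        exact ⟨y, by linarith [blockRadius_pos N], hy2⟩
      · exact ⟨_, hy, (h.flow N).eq_self 1 _ h1⟩
    have hm : blockCenter N + y ∈ Metric.closedBall (blockCenter N) (blockRadius N) := by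
      rwa [mem_closedBall_iff_norm, add_sub_cancel_left]
    refine ⟨_, hm, ?_⟩
    rw [h.sumFlow_of_mem 1 hm, add_sub_cancel_left, hYy, add_sub_cancel]

/-! #### Entropy -/

theorem exists_horseshoe (h : IsBlockFamily ω ε F₁ F₂ Y ρ) (N : ℕ+) :
    ∃ H : Fin (3 ^ (N : ℕ)) → Set Torus, (∀ j, IsCompact (H j)) ∧
      (Pairwise fun i j => Disjoint (H i) (H j)) ∧ (∀ j, ∀ x ∈ H j, ‖x‖ ≤ blockRadius N / 2) ∧
      ∀ n : ℕ, 0 < n → ∀ w : Fin n → Fin (3 ^ (N : ℕ)),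
        ∃ x, ∀ i : Fin n, (Y N 1)^[(i : ℕ)] x ∈ H (w i) := by
  refine (h.shear N).exists_horseshoe (by positivity) ?_ (h.field₁ N) (h.field₂ N) (h.flow N)
  rw [blockRadius_eq]
  linarith [half_pow_le N]

theorem le_topEntropy_block (h : IsBlockFamily ω ε F₁ F₂ Y ρ) (N : ℕ+) :
    ((N : ℕ) : EReal) ≤ topEntropy (Y N 1) := by
  obtain ⟨H, hc, hd, -, ho⟩ := h.exists_horseshoe N
  exact (natCast_le_log_three_pow N).trans
    (log_le_topEntropy (fun j => (hc j).isClosed) hd (by positivity) ho)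

theorem sumFlow_iterate (h : IsBlockFamily ω ε F₁ F₂ Y ρ) (N : ℕ+) {y : Torus}
    (hy : ‖y‖ ≤ blockRadius N) (i : ℕ) :
    ‖(Y N 1)^[i] y‖ ≤ blockRadius N ∧
      (sumFlow Y 1)^[i] (blockCenter N + y) = blockCenter N + (Y N 1)^[i] y := by
  induction i with
  | zero => exact ⟨hy, rfl⟩
  | succ i ih =>
    rw [Function.iterate_succ_apply', Function.iterate_succ_apply', ih.2]
    refine ⟨h.flow_norm_le 1 N ih.1, ?_⟩
    rw [h.sumFlow_of_mem 1 (N := N), add_sub_cancel_left]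
    rw [mem_closedBall_iff_norm, add_sub_cancel_left]
    exact ih.1

/-- Translation by the centre conjugates the block to the sum on its invariant ball, so each
horseshoe is carried over to the sum. No comparison with the entropy of a subsystem is needed. -/
theorem topEntropy_sumFlow (h : IsBlockFamily ω ε F₁ F₂ Y ρ) : topEntropy (sumFlow Y 1) = ⊤ := by
  have key : ∀ N : ℕ+, ((N : ℕ) : EReal) ≤ topEntropy (sumFlow Y 1) := by
    intro N
    obtain ⟨H, hc, hd, hr, ho⟩ := h.exists_horseshoe N
    refine (natCast_le_log_three_pow N).trans (log_le_topEntropy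
      (H := fun j => (fun y => blockCenter N + y) '' H j)
      (fun j => ((hc j).image (continuous_const.add continuous_id)).isClosed)
      (fun i j hij => (disjoint_image_iff (add_right_injective _)).2 (hd hij)) (by positivity)
      fun n hn w => ?_)
    obtain ⟨y, hy⟩ := ho n hn w
    have hy0 : ‖y‖ ≤ blockRadius N := by
      have := hr _ _ (hy ⟨0, hn⟩)
      simp only [Function.iterate_zero, id_eq] at this
      linarith [blockRadius_pos N]
    exact ⟨blockCenter N + y, fun i => ⟨_, hy i, ((h.sumFlow_iterate N hy0 i).2).symm⟩⟩
  refine (EReal.eq_top_iff_forall_lt _).2 fun y => ?_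
  obtain ⟨n, hn⟩ := exists_nat_gt y
  refine lt_of_lt_of_le ?_ (key n.succPNat)
  have : y < ((n.succPNat : ℕ) : ℝ) := by
    rw [Nat.succPNat_coe]
    push_cast
    linarith
  exact_mod_cast this

end IsBlockFamily

end OsgoodEntropy

theorem mainTheorem3 (ω : ℝ → ℝ) (hω : IsOsgoodModulus ω) :
    ∃ (B : ℕ+ → ℝ → Torus → Plane) (Y : ℕ+ → ℝ → Torus → Torus)
      (b : ℝ → Torus → Plane) (X : ℝ → Torus → Torus),
      -- the blocks
      (∀ N : ℕ+,
        IsSmoothField (B N) ∧ IsIncompressible (B N) ∧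
        MemCZero ω (B N) ∧ cZeroNorm ω (B N) ≤ (((N : ℕ) : ℝ≥0∞) ^ 2)⁻¹ ∧
        spaceTimeSupport (B N) ⊆ Icc 0 1 ×ˢ Metric.ball 0 (blockRadius N) ∧
        IsFlowMap (periodize (B N)) (Y N) ∧ Continuous (Y N 1) ∧
        ((N : ℕ) : EReal) ≤ topEntropy (Y N 1)) ∧
      -- the translated blocks live in disjoint balls, and `b` is their sum
      (Pairwise fun M N : ℕ+ =>
        Disjoint (Metric.closedBall (blockCenter M) (blockRadius M))
          (Metric.closedBall (blockCenter N) (blockRadius N))) ∧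
      (∀ t, 0 ≤ t → ∀ x, HasSum (fun N : ℕ+ => periodize (B N) t (x - blockCenter N)) (b t x)) ∧
      -- regularity of `b`
      MemLOnePer ω b ∧
      (∀ t, 0 ≤ t → omegaNorm ω (b t) ≤ ∑' N : ℕ+, (((N : ℕ) : ℝ≥0∞) ^ 2)⁻¹) ∧
      -- the time-one flow map of `b`
      IsFlowMap b X ∧ Continuous (X 1) ∧
      (∀ N : ℕ+, ∀ x ∈ Metric.ball (blockCenter N) (blockRadius N),
        X 1 x = blockCenter N + Y N 1 (x - blockCenter N)) ∧
      (∀ N : ℕ+, X 1 '' Metric.closedBall (blockCenter N) (blockRadius N) =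
        Metric.closedBall (blockCenter N) (blockRadius N)) ∧
      topEntropy (X 1) = ⊤ := by
  obtain ⟨ε, F₁, F₂, Y, ρ, h⟩ := exists_isBlockFamily hω
  refine ⟨fun N => blockField (F₁ N) (F₂ N), Y, sumField F₁ F₂, sumFlow Y, fun N => ?_,
    disjoint_closedBall_blocks, fun t _ x => h.hasSum_sumField t x, h.sumField_memLOnePer hω,
    fun t _ => h.omegaNorm_sumField_le hω t, h.sumFlow_isFlowMap hω, h.sumFlow_continuous,
    fun N x hx => h.sumFlow_of_mem 1 (Metric.ball_subset_closedBall hx), h.sumFlow_image,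
    h.topEntropy_sumFlow⟩
  have h₁ := h.field₁ N
  have h₂ := h.field₂ N
  refine ⟨blockField_isSmoothField h₁ h₂, blockField_isIncompressible h₁ h₂,
    blockField_memCZero hω.pos h₁ h₂, iSup₂_le fun t ht => h.omegaNorm_block_le hω ht N,
    (blockField_support h₁ h₂).trans (prod_mono_right
      (Metric.closedBall_subset_ball (IsBlockFamily.half_lt le_rfl))),
    (h.flow N).isFlowMap, (h.flow N).continuous, h.le_topEntropy_block N⟩
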